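/- Let $R$ be a (not necessarily commutative) profinite ring with unity, and let $R\text{-}\mathsf{PMod}$ be the category of profinite left $R$-modules and continuous $R$-linear maps. For a profinite space $X$ let $\mathcal{O}(X)$ be the poset of clopen subsets of $X$. A *precosheaf* of profinite $R$-modules is a pair $(\mathsf{M},X)$ of a profinite space $X$ and a functor $\mathsf{M}\colon\mathcal{O}(X)\to R\text{-}\mathsf{PMod}$, with maps $\mathrm{cor}_U^V\colon \mathsf{M}(U)\to\mathsf{M}(V)$ for $U\subseteq V$. A morphism $(\Psi,f)\colon(\mathsf{N},Y)\to(\mathsf{M},X)$ consists of a continuous map $f\colon Y\to X$ and continuous $R$-linear maps $\Psi_{U,V}\colon \mathsf{N}(f^{-1}(U)\cap V)\to\mathsf{M}(U)$, natural in $(U,V)\in\mathcal{O}(X)\times\mathcal{O}(Y)$. A *cosheaf* is a precosheaf such that for every finite (possibly empty) family $U_1,\dots,U_n\in\mathcal{O}(X)$ the sequence $$\bigoplus_{i,j}\mathsf{M}(U_i\cap U_j)\xrightarrow{\;p-q\;}\bigoplus_i\mathsf{M}(U_i)\longrightarrow\mathsf{M}(U_1\cup\dots\cup U_n)\longrightarrow0$$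 is exact, where $p=\sum_{i,j}\mathrm{cor}_{U_i\cap U_j}^{U_i}$ and $q=\sum_{i,j}\mathrm{cor}_{U_i\cap U_j}^{U_j}$. Cosheaves and morphisms of precosheaves between them form the category $R\text{-}\mathsf{CoShf}$. A *`sheaf'* of profinite $R$-modules is a triple $(\mathcal{M},p,X)$ of a continuous surjection $p\colon\mathcal{M}\to X$ of profinite spaces and a profinite $R$-module structure on each fibre $M_x=p^{-1}(x)$ such that scalar multiplication $R\times\mathcal{M}\to\mathcal{M}$ and addition $\mathcal{M}\times_X\mathcal{M}\to\mathcal{M}$ are continuous. A morphism $(\psi,f)\colon(\mathcal{N},q,Y)\to(\mathcal{M},p,X)$ consists of continuous maps $\psi\colon\mathcal{N}\to\mathcal{M}$ and $f\colon Y\to X$ with $p\psi=fq$ such that $\psi$ is $R$-linear on each fibre. These form the category $R\text{-}\mathsf{P`Shf'}$. For $U\in\mathcal{O}(X)$ the *profinite direct sum* $\boxplus_{u\in U}M_u$ is a profinite $R$-module with a continuous, fibrewise $R$-linear map $\omega\colon p^{-1}(U)\to\boxplus_{u\in U}M_u$ through which every continuous, fibrewise $R$-linear map from $p^{-1}(U)$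 to a profinite $R$-module factors by a unique continuous $R$-linear map. For a `sheaf' $\mathcal{M}$ put $\mathsf{CoShf}(\mathcal{M})(U)=\boxplus_{u\in U}M_u$, with the maps induced by the inclusions $p^{-1}(U)\subseteq p^{-1}(V)$; a morphism $(\psi,f)$ of `sheaves' is sent to $(\Psi,f)$, where $\Psi_{U,V}\colon\boxplus_{y\in f^{-1}(U)\cap V}N_y\to\boxplus_{u\in U}M_u$ is induced by $\psi$. For a cosheaf $\mathsf{M}$ put $$\mathsf{Co\acute{E}tale}(\mathsf{M})=\bigsqcup_{x\in X}M_x,\qquad M_x=\varprojlim_{U\ni x}\mathsf{M}(U),$$ with projections $\mathrm{cor}_x^U\colon M_x\to\mathsf{M}(U)$ and the topology generated by the sets $\{(m,x)\mid x\in U,\ \mathrm{cor}_x^U(m)\in W\}$ for $U\in\mathcal{O}(X)$ and $W\subseteq\mathsf{M}(U)$ open; a morphism $(\Psi,f)\colon(\mathsf{N},Y)\to(\mathsf{M},X)$ is sent to $(\psi,f)$, where $\psi$ is given on $N_y\to M_{f(y)}$ by the composites $N_y\to\mathsf{N}(f^{-1}(U))\xrightarrow{\Psi_{U,Y}}\mathsf{M}(U)$.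 **Theorem.** Each precosheaf $\mathsf{CoShf}(\mathcal{M})$ is a cosheaf, and these constructions are functors $$\mathsf{Co\acute{E}tale}\colon R\text{-}\mathsf{CoShf}\to R\text{-}\mathsf{P`Shf'},\qquad \mathsf{CoShf}\colon R\text{-}\mathsf{P`Shf'}\to R\text{-}\mathsf{CoShf}$$ which are mutually quasi-inverse, and so define an equivalence of categories. -/

import Mathlib

open CategoryTheory TopologicalSpace

universe u

namespace ProfSheaf

/-! ### Profinite modules -/

/-- A profinite left `R`-module: a topological `R`-module with (jointly) continuous action whose
underlying space is profinite, i.e. compact, Hausdorff and totally disconnected. -/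
structure PMod (R : Type u) [Ring R] [TopologicalSpace R] where
  carrier : Type u
  [addCommGroup : AddCommGroup carrier]
  [module : Module R carrier]
  [topologicalSpace : TopologicalSpace carrier]
  [isTopologicalAddGroup : IsTopologicalAddGroup carrier]
  [continuousSMul : ContinuousSMul R carrier]
  [compactSpace : CompactSpace carrier]
  [t2Space : T2Space carrier]
  [totallyDisconnectedSpace : TotallyDisconnectedSpace carrier]

attribute [instance] PMod.addCommGroup PMod.module PMod.topologicalSpace
  PMod.isTopologicalAddGroup PMod.continuousSMul PMod.compactSpace PMod.t2Space
  PMod.totallyDisconnectedSpace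

section

variable (R : Type u) [Ring R] [TopologicalSpace R]

instance : CoeSort (PMod R) (Type u) := ⟨PMod.carrier⟩

/-- The category of profinite `R`-modules and continuous `R`-linear maps. -/
instance : Category (PMod R) where
  Hom M N := M →L[R] N
  id M := ContinuousLinearMap.id R M
  comp f g := ContinuousLinearMap.comp g f

/-! ### Precosheaves and cosheaves -/

/-- The preimage of a clopen set under a continuous map. -/
def preim {Y X : Type u} [TopologicalSpace Y] [TopologicalSpace X] (f : C(Y, X))
    (U : Clopens X) : Clopens Y :=
  ⟨f ⁻¹' (U : Set X), U.isClopen.preimage f.continuous⟩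

theorem preim_mono {Y X : Type u} [TopologicalSpace Y] [TopologicalSpace X] (f : C(Y, X))
    {U U' : Clopens X} (h : U ≤ U') : preim f U ≤ preim f U' :=
  fun _ hy => h hy

theorem preim_id {X : Type u} [TopologicalSpace X] (U : Clopens X) :
    preim (ContinuousMap.id X) U = U :=
  rfl

theorem preim_comp {Z Y X : Type u} [TopologicalSpace Z] [TopologicalSpace Y] [TopologicalSpace X]
    (f : C(Y, X)) (g : C(Z, Y)) (U : Clopens X) : preim (f.comp g) U = preim g (preim f U) :=
  rfl

/-- A precosheaf of profinite `R`-modules `(M, X)`: a profinite space `X` and a covariant functor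
from the poset of compact open (equivalently clopen) subsets of `X` to profinite modules. -/
structure PreCoShf where
  X : Profinite.{u}
  F : Clopens X ⥤ PMod R

variable {R}

/-- The corestriction map `M(U) → M(V)` for `U ≤ V`. -/
def PreCoShf.cor (M : PreCoShf R) {U V : Clopens M.X} (h : U ≤ V) : M.F.obj U →L[R] M.F.obj V :=
  M.F.map (homOfLE h)

theorem PreCoShf.cor_self (M : PreCoShf R) {U : Clopens M.X} (h : U ≤ U) (a : M.F.obj U) :
    M.cor h a = a :=
  congrArg (fun φ : M.F.obj U →L[R] M.F.obj U => φ a) (M.F.map_id U)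

theorem PreCoShf.cor_cor (M : PreCoShf R) {U V W : Clopens M.X} (h : U ≤ V) (k : V ≤ W)
    (a : M.F.obj U) : M.cor k (M.cor h a) = M.cor (h.trans k) a :=
  (congrArg (fun φ : M.F.obj U →L[R] M.F.obj W => φ a)
    (M.F.map_comp (homOfLE h) (homOfLE k))).symm

/-- A morphism of precosheaves `(Ψ, f) : (N, Y) → (M, X)`: a continuous map `f : Y → X` and maps
`Ψ_{U,V} : N(f⁻¹(U) ∩ V) → M(U)` natural in the pair of clopen sets `U ⊆ X`, `V ⊆ Y`. -/
structure PreCoShf.Hom (N M : PreCoShf R) where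
  base : C(N.X, M.X)
  app : ∀ (U : Clopens M.X) (V : Clopens N.X), N.F.obj (preim base U ⊓ V) →L[R] M.F.obj U
  naturality : ∀ {U U' : Clopens M.X} {V V' : Clopens N.X} (hU : U ≤ U') (hV : V ≤ V')
    (a : N.F.obj (preim base U ⊓ V)),
    app U' V' (N.cor (inf_le_inf (preim_mono base hU) hV) a) = M.cor hU (app U V a)

theorem PreCoShf.Hom.ext' {N M : PreCoShf R} {φ ψ : PreCoShf.Hom N M} (h : φ.base = ψ.base)
    (h' : ∀ U V (hle : preim φ.base U ⊓ V ≤ preim ψ.base U ⊓ V) (a : N.F.obj (preim φ.base U ⊓ V)),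
      ψ.app U V (N.cor hle a) = φ.app U V a) : φ = ψ := by
  obtain ⟨f, p, hp⟩ := φ
  obtain ⟨g, q, hq⟩ := ψ
  obtain rfl : f = g := h
  congr 1
  funext U V
  ext a
  rw [← h' U V le_rfl a, N.cor_self]

/-- The identity morphism is given by the corestrictions `M(U ∩ V) → M(U)`. -/
def PreCoShf.Hom.id (M : PreCoShf R) : PreCoShf.Hom M M where
  base := ContinuousMap.id M.X
  app U V := M.cor (inf_le_left.trans (preim_id U).le)
  naturality hU hV a := by rw [M.cor_cor, M.cor_cor]

/-- The composite of `(Φ, g) : (P, Z) → (N, Y)` and `(Ψ, f) : (N, Y) → (M, X)` is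
`P((fg)⁻¹(U) ∩ V) = P(g⁻¹(f⁻¹(U)) ∩ V) → N(f⁻¹(U)) = N(f⁻¹(U) ∩ Y) → M(U)`. -/
def PreCoShf.Hom.comp {P N M : PreCoShf R} (Φ : PreCoShf.Hom P N) (Ψ : PreCoShf.Hom N M) :
    PreCoShf.Hom P M where
  base := Ψ.base.comp Φ.base
  app U V := (Ψ.app U ⊤).comp <| (N.cor (le_inf le_rfl le_top)).comp <|
    (Φ.app (preim Ψ.base U) V).comp <|
      P.cor (inf_le_inf_right V (preim_comp Ψ.base Φ.base U).le)
  naturality {U U' V V'} hU hV a := by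
    simp only [ContinuousLinearMap.comp_apply]
    have h1 := Φ.naturality (preim_mono Ψ.base hU) hV
      (P.cor (inf_le_inf_right V (preim_comp Ψ.base Φ.base U).le) a)
    have h2 := Ψ.naturality hU (le_refl (⊤ : Clopens N.X)) (N.cor (le_inf le_rfl le_top)
      (Φ.app (preim Ψ.base U) V (P.cor (inf_le_inf_right V (preim_comp Ψ.base Φ.base U).le) a)))
    rw [← h2, N.cor_cor, P.cor_cor]
    rw [P.cor_cor] at h1
    rw [h1, N.cor_cor]

/-- The category of precosheaves of profinite `R`-modules over varying profinite spaces. -/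
instance : Category (PreCoShf R) where
  Hom N M := PreCoShf.Hom N M
  id M := PreCoShf.Hom.id M
  comp Φ Ψ := PreCoShf.Hom.comp Φ Ψ
  id_comp {N M} Ψ := by
    refine PreCoShf.Hom.ext' rfl fun U V hle a => ?_
    have h := Ψ.naturality (le_refl U) (le_top : V ≤ ⊤) (N.cor hle a)
    rw [M.cor_self, N.cor_cor] at h
    refine h.symm.trans (congrArg (Ψ.app U ⊤) ?_)
    exact ((N.cor_cor _ _ _).trans (N.cor_cor _ _ _)).symm
  comp_id {N M} Ψ := by
    refine PreCoShf.Hom.ext' rfl fun U V hle a => ?_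
    have h := Ψ.naturality (preim_id U).le (le_refl V)
      (N.cor (hle.trans (inf_le_inf_right V (preim_mono Ψ.base (preim_id U).ge))) a)
    rw [N.cor_cor] at h
    exact h.trans (M.cor_cor _ _ _).symm
  assoc {Q P N M} Θ Φ Ψ := by
    refine PreCoShf.Hom.ext' rfl fun U V hle a => ?_
    have h := Θ.naturality (preim_comp Ψ.base Φ.base U).le (le_refl V)
      (Q.cor (hle.trans (inf_le_inf_right V (preim_comp (Ψ.base.comp Φ.base) Θ.base U).le)) a)
    rw [Q.cor_cor] at h
    refine congrArg (Ψ.app U ⊤) (congrArg (N.cor _) (congrArg (Φ.app (preim Ψ.base U) ⊤) ?_))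
    refine (P.cor_cor _ _ _).trans ((congrArg (P.cor _) (congrArg (Θ.app _ V)
      (Q.cor_cor _ _ _))).trans ?_)
    refine Eq.trans ?_ (congrArg (P.cor _) ((congrArg (Θ.app _ V) (Q.cor_cor _ _ _)).trans h).symm)
    exact (P.cor_cor _ _ _).symm

/-- The map `⨁_i M(U_i) → M(U_1 ∪ ⋯ ∪ U_n)`. -/
def PreCoShf.sumMap (M : PreCoShf R) {n : ℕ} (U : Fin n → Clopens M.X) :
    (∀ i, M.F.obj (U i)) →ₗ[R] M.F.obj (Finset.univ.sup U) :=
  ∑ i, (M.cor (Finset.le_sup (f := U) (Finset.mem_univ i))).toLinearMap ∘ₗ LinearMap.proj i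

/-- The map `p = ∑_{i,j} cor_{U_i ∩ U_j}^{U_i}`, from `⨁_{i,j} M(U_i ∩ U_j)` to `⨁_i M(U_i)`. -/
def PreCoShf.pMap (M : PreCoShf R) {n : ℕ} (U : Fin n → Clopens M.X) :
    (∀ ij : Fin n × Fin n, M.F.obj (U ij.1 ⊓ U ij.2)) →ₗ[R] ∀ i, M.F.obj (U i) :=
  ∑ ij : Fin n × Fin n, LinearMap.single R (fun i => (M.F.obj (U i) : Type u)) ij.1 ∘ₗ
    (M.cor (inf_le_left : U ij.1 ⊓ U ij.2 ≤ U ij.1)).toLinearMap ∘ₗ LinearMap.proj ij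

/-- The map `q = ∑_{i,j} cor_{U_i ∩ U_j}^{U_j}`, from `⨁_{i,j} M(U_i ∩ U_j)` to `⨁_i M(U_i)`. -/
def PreCoShf.qMap (M : PreCoShf R) {n : ℕ} (U : Fin n → Clopens M.X) :
    (∀ ij : Fin n × Fin n, M.F.obj (U ij.1 ⊓ U ij.2)) →ₗ[R] ∀ i, M.F.obj (U i) :=
  ∑ ij : Fin n × Fin n, LinearMap.single R (fun i => (M.F.obj (U i) : Type u)) ij.2 ∘ₗ
    (M.cor (inf_le_right : U ij.1 ⊓ U ij.2 ≤ U ij.2)).toLinearMap ∘ₗ LinearMap.proj ij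

variable (R)

/-- A precosheaf is a cosheaf if for every finite family of clopen sets (the empty family
included, which says `M(∅) = 0`) the sequence
`⨁_{i,j} M(U_i ∩ U_j) → ⨁_i M(U_i) → M(U_1 ∪ ⋯ ∪ U_n) → 0` is exact, the first map being
`p - q`. -/
def isCosheaf : ObjectProperty (PreCoShf R) := fun M =>
  ∀ (n : ℕ) (U : Fin n → Clopens M.X),
    Function.Exact (M.pMap U - M.qMap U) (M.sumMap U) ∧ Function.Surjective (M.sumMap U)

/-- The category of cosheaves of profinite `R`-modules, a full subcategory of precosheaves. -/
abbrev CoShf := (isCosheaf R).FullSubcategory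

/-! ### `Sheaves' of profinite modules -/

/-- The fibre of a map over a point. -/
abbrev Fibre {E X : Type u} (p : E → X) (x : X) : Type u := {m : E // p m = x}

/-- A `sheaf' of profinite `R`-modules `(M, p, X)`: a continuous surjection `p : M → X` of profinite
spaces together with `R`-module structures on the fibres such that the maps `R × M → M` and
`M ×_X M → M` given by scalar multiplication and addition are continuous. (The fibres are
then profinite `R`-modules in the subspace topology.) -/
structure PShf where
  X : Profinite.{u}
  total : Profinite.{u}
  p : C(total, X)
  surjective : Function.Surjective p
  [addCommGroup : ∀ x, AddCommGroup (Fibre p x)]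
  [module : ∀ x, Module R (Fibre p x)]
  continuous_smul : Continuous fun z : R × total => (z.1 • (⟨z.2, rfl⟩ : Fibre p (p z.2))).1
  continuous_add : Continuous fun z : {z : total × total // p z.1 = p z.2} =>
    ((⟨z.1.1, z.2⟩ : Fibre p (p z.1.2)) + ⟨z.1.2, rfl⟩).1

attribute [instance] PShf.addCommGroup PShf.module

/-- The map `N_y → M_{f(y)}` on fibres induced by `ψ : N → M` lying over `f : Y → X`. -/
def Fibre.map {E X E' X' : Type u} {p : E → X} {p' : E' → X'} {ψ : E → E'} {f : X → X'}
    (h : ∀ m, p' (ψ m) = f (p m)) (x : X) (a : Fibre p x) : Fibre p' (f x) :=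
  ⟨ψ a.1, (h a.1).trans (congrArg f a.2)⟩

variable {R}

/-- A morphism of `sheaves' `(ψ, f)`: continuous maps `ψ` of total spaces and `f` of base spaces
that commute with the projections, such that `ψ` is `R`-linear on each fibre. -/
structure PShf.Hom (N M : PShf R) where
  base : C(N.X, M.X)
  map : C(N.total, M.total)
  comm : ∀ m, M.p (map m) = base (N.p m)
  map_add : ∀ y (a b : Fibre N.p y),
    Fibre.map comm y (a + b) = Fibre.map comm y a + Fibre.map comm y b
  map_smul : ∀ y (r : R) (a : Fibre N.p y), Fibre.map comm y (r • a) = r • Fibre.map comm y a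

theorem PShf.Hom.ext' {N M : PShf R} {φ ψ : PShf.Hom N M} (h : φ.base = ψ.base)
    (h' : φ.map = ψ.map) : φ = ψ := by
  cases φ; cases ψ; cases h; cases h'; rfl

/-- The category of `sheaves' of profinite `R`-modules. -/
instance : Category (PShf R) where
  Hom N M := PShf.Hom N M
  id M :=
    { base := ContinuousMap.id _
      map := ContinuousMap.id _
      comm := fun _ => rfl
      map_add := fun _ _ _ => rfl
      map_smul := fun _ _ _ => rfl }
  comp {P N M} φ ψ :=
    { base := ψ.base.comp φ.base
      map := ψ.map.comp φ.map
      comm := fun m => (ψ.comm _).trans (congrArg ψ.base (φ.comm m))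
      map_add := fun y a b => by
        have h1 := φ.map_add y a b
        have h2 := ψ.map_add _ (Fibre.map φ.comm y a) (Fibre.map φ.comm y b)
        rw [← h1] at h2
        exact h2
      map_smul := fun y r a => by
        have h1 := φ.map_smul y r a
        have h2 := ψ.map_smul _ r (Fibre.map φ.comm y a)
        rw [← h1] at h2
        exact h2 }

/-! ### Profinite direct sums and the functor to cosheaves -/

/-- The total space `p⁻¹(U)` of the restriction of a `sheaf' to a clopen set `U`. -/
abbrev PShf.Over (M : PShf R) (U : Clopens M.X) : Type u := {m : M.total // M.p m ∈ U}

/-- A point of the fibre over `x ∈ U`, as a point of `p⁻¹(U)`. -/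
def PShf.toOver (M : PShf R) {U : Clopens M.X} {x : M.X} (hx : x ∈ U) (a : Fibre M.p x) :
    M.Over U :=
  ⟨a.1, by rw [a.2]; exact hx⟩

/-- A `sheaf' morphism from the restriction of the `sheaf' `M` to the clopen set `U` to a profinite
`R`-module `P`, viewed as a `sheaf' over a point: a continuous map `p⁻¹(U) → P` that is `R`-linear
on each fibre. -/
@[ext]
structure PShf.HomOver (M : PShf R) (U : Clopens M.X) (P : PMod R) where
  toMap : C(M.Over U, P)
  map_add : ∀ x (hx : x ∈ U) (a b : Fibre M.p x),
    toMap (M.toOver hx (a + b)) = toMap (M.toOver hx a) + toMap (M.toOver hx b)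
  map_smul : ∀ x (hx : x ∈ U) (r : R) (a : Fibre M.p x),
    toMap (M.toOver hx (r • a)) = r • toMap (M.toOver hx a)

/-- The universal property of the profinite direct sum of the `sheaf' `M` restricted to `U`:
`ω : p⁻¹(U) → D` is universal among `sheaf' morphisms to profinite `R`-modules. -/
def PShf.IsDirectSum (M : PShf R) (U : Clopens M.X) (D : PMod R) (ω : M.HomOver U D) : Prop :=
  ∀ (P : PMod R) (β : M.HomOver U P), ∃! φ : D →L[R] P, ∀ m, φ (ω.toMap m) = β.toMap m

/-- A continuous linear map applied after a `sheaf' morphism to a module. -/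
def PShf.HomOver.postcomp {M : PShf R} {U : Clopens M.X} {P Q : PMod R} (β : M.HomOver U P)
    (φ : P →L[R] Q) : M.HomOver U Q where
  toMap := (φ : C(P, Q)).comp β.toMap
  map_add x hx a b := (congrArg φ (β.map_add x hx a b)).trans (_root_.map_add φ _ _)
  map_smul x hx r a := (congrArg φ (β.map_smul x hx r a)).trans (_root_.map_smul φ _ _)

/-- The profinite module given by a closed submodule. -/
def PMod.ofClosed {P : Type u} [AddCommGroup P] [Module R P] [TopologicalSpace P]
    [IsTopologicalAddGroup P] [ContinuousSMul R P] [CompactSpace P] [T2Space P]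
    [TotallyDisconnectedSpace P] (W : Submodule R P) (hW : IsClosed (W : Set P)) : PMod R :=
  haveI : CompactSpace W := isCompact_iff_compactSpace.mp hW.isCompact
  { carrier := W }

/-- The profinite module structure transported along a bijection. -/
def PMod.transport {A : Type u} (P : PMod R) (e : A ≃ P) : PMod R :=
  letI := e.addCommGroup
  letI := e.module R
  letI : TopologicalSpace A := TopologicalSpace.induced e inferInstance
  let h : A ≃ₜ P := e.toHomeomorphOfIsInducing ⟨rfl⟩
  haveI : CompactSpace A := h.symm.compactSpace
  haveI : T2Space A := h.symm.t2Space
  haveI : TotallyDisconnectedSpace A := h.symm.totallyDisconnectedSpace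
  haveI : IsTopologicalAddGroup A :=
    { continuous_add := by
        refine continuous_induced_rng.mpr ?_
        have : (e ∘ fun z : A × A => z.1 + z.2) = fun z => e z.1 + e z.2 := by
          funext z; exact e.apply_symm_apply _
        rw [this]
        exact (h.continuous.comp continuous_fst).add (h.continuous.comp continuous_snd)
      continuous_neg := by
        refine continuous_induced_rng.mpr ?_
        have : (e ∘ fun z : A => -z) = fun z => -e z := by
          funext z; exact e.apply_symm_apply _
        rw [this]
        exact h.continuous.neg }
  haveI : ContinuousSMul R A := ⟨by
    refine continuous_induced_rng.mpr ?_
    have : (e ∘ fun z : R × A => z.1 • z.2) = fun z => z.1 • e z.2 := by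
      funext z; exact e.apply_symm_apply _
    rw [this]
    exact continuous_fst.smul (h.continuous.comp continuous_snd)⟩
  { carrier := A }

/-- The transported module is isomorphic to the original one. -/
def PMod.transportEquiv {A : Type u} (P : PMod R) (e : A ≃ P) : (P.transport e) ≃L[R] P where
  toFun := e
  invFun := e.symm
  left_inv := e.left_inv
  right_inv := e.right_inv
  map_add' _ _ := e.apply_symm_apply _
  map_smul' _ _ := e.apply_symm_apply _
  continuous_toFun := continuous_induced_dom
  continuous_invFun := (e.toHomeomorphOfIsInducing (Y := P) (X := P.transport e) ⟨rfl⟩).symm.continuous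

/-- A Hausdorff space with a dense subset indexed by `D` has at most `2 ^ 2 ^ |D|` points. -/
theorem exists_injective_of_dense {D Y : Type u} [TopologicalSpace Y] [T2Space Y] (b : D → Y)
    (hb : DenseRange b) : ∃ ι : Y → Set (Set D), Function.Injective ι := by
  refine ⟨fun y => {S | ∃ V ∈ nhds y, b ⁻¹' V = S}, fun y y' h => ?_⟩
  by_contra hne
  obtain ⟨V, V', hV, hV', hd⟩ := t2_separation_nhds hne
  obtain ⟨W, hW, hWV⟩ : b ⁻¹' V ∈ {S | ∃ V ∈ nhds y', b ⁻¹' V = S} := by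
    change _ ∈ (fun y => {S | ∃ V ∈ nhds y, b ⁻¹' V = S}) y'
    rw [← h]
    exact ⟨V, hV, rfl⟩
  obtain ⟨z, ⟨d, rfl⟩, hz, hz'⟩ := hb.inter_nhds_nonempty (Filter.inter_mem hW hV')
  have hzV : d ∈ b ⁻¹' V := by rw [← hWV]; exact hz
  exact Set.disjoint_left.mp hd hzV hz'

/-- Module structures on a type `A` making it a profinite module, as a `u`-small type. -/
structure PMod.Str (R : Type u) [Ring R] [TopologicalSpace R] (A : Type u) : Type u where
  [addCommGroup : AddCommGroup A]
  [module : Module R A]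
  [topologicalSpace : TopologicalSpace A]
  [isTopologicalAddGroup : IsTopologicalAddGroup A]
  [continuousSMul : ContinuousSMul R A]
  [compactSpace : CompactSpace A]
  [t2Space : T2Space A]
  [totallyDisconnectedSpace : TotallyDisconnectedSpace A]

/-- The profinite module given by a structure on `A`. -/
def PMod.Str.toPMod {A : Type u} (σ : PMod.Str R A) : PMod R :=
  { σ with carrier := A }

theorem PShf.exists_isDirectSum (M : PShf R) (U : Clopens M.X) :
    ∃ (D : PMod R) (ω : M.HomOver U D), M.IsDirectSum U D ω := by
  let D₀ : Type u := M.Over U →₀ R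
  let I : Type u := Σ (A : Set (Set (Set D₀))) (σ : PMod.Str R A), M.HomOver U σ.toPMod
  let T : I → PMod R := fun i => i.2.1.toPMod
  let ω₀ : C(M.Over U, ∀ i, T i) :=
    ⟨fun m i => i.2.2.toMap m, continuous_pi fun i => i.2.2.toMap.continuous⟩
  let W : Submodule R (∀ i, T i) := (Submodule.span R (Set.range ω₀)).topologicalClosure
  have hW : ∀ m, ω₀ m ∈ W := fun m =>
    Submodule.le_topologicalClosure _ (Submodule.subset_span ⟨m, rfl⟩)
  let D : PMod R := PMod.ofClosed W (Submodule.isClosed_topologicalClosure _)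
  let ω : M.HomOver U D :=
    { toMap := ⟨fun m => ⟨ω₀ m, hW m⟩, ω₀.continuous.subtype_mk _⟩
      map_add := fun x hx a b => Subtype.ext (funext fun i => i.2.2.map_add x hx a b)
      map_smul := fun x hx r a => Subtype.ext (funext fun i => i.2.2.map_smul x hx r a) }
  refine ⟨D, ω, fun P β => ?_⟩
  refine existsUnique_of_exists_of_unique ?_ ?_
  · let V : Submodule R P := (Submodule.span R (Set.range β.toMap)).topologicalClosure
    have hV : ∀ m, β.toMap m ∈ V := fun m =>
      Submodule.le_topologicalClosure _ (Submodule.subset_span ⟨m, rfl⟩)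
    let Q : PMod R := PMod.ofClosed V (Submodule.isClosed_topologicalClosure _)
    have hb : ∀ d : D₀, Finsupp.linearCombination R β.toMap d ∈ V := fun d =>
      Submodule.le_topologicalClosure _ (by
        rw [← Finsupp.range_linearCombination]; exact ⟨d, rfl⟩)
    let b : D₀ → Q := fun d => ⟨Finsupp.linearCombination R β.toMap d, hb d⟩
    have hdense : DenseRange b := by
      intro y
      change V at y
      refine closure_subtype.mpr ?_
      have hy : y.1 ∈ closure (Submodule.span R (Set.range β.toMap) : Set P) := y.2
      refine closure_mono ?_ hy
      rw [← Finsupp.range_linearCombination]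
      rintro _ ⟨d, rfl⟩
      exact ⟨_, ⟨d, rfl⟩, rfl⟩
    obtain ⟨ι, hι⟩ := exists_injective_of_dense b hdense
    let e : Set.range ι ≃ Q := (Equiv.ofInjective ι hι).symm
    let Q' : PMod R := Q.transport e
    let ε : Q' ≃L[R] Q := Q.transportEquiv e
    let βQ : M.HomOver U Q :=
      { toMap := ⟨fun m => ⟨β.toMap m, hV m⟩, β.toMap.continuous.subtype_mk _⟩
        map_add := fun x hx a b => Subtype.ext (β.map_add x hx a b)
        map_smul := fun x hx r a => Subtype.ext (β.map_smul x hx r a) }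
    let σ : PMod.Str R (Set.range ι) :=
      { addCommGroup := Q'.addCommGroup
        module := Q'.module
        topologicalSpace := Q'.topologicalSpace
        isTopologicalAddGroup := Q'.isTopologicalAddGroup
        continuousSMul := Q'.continuousSMul
        compactSpace := Q'.compactSpace
        t2Space := Q'.t2Space
        totallyDisconnectedSpace := Q'.totallyDisconnectedSpace }
    let i : I := ⟨Set.range ι, σ, βQ.postcomp (Q := Q') ε.symm.toContinuousLinearMap⟩
    let π : D →L[R] Q' := (ContinuousLinearMap.proj (φ := fun i => T i) i).comp W.subtypeL
    let κ : Q →L[R] P := V.subtypeL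
    refine ⟨κ.comp (ε.toContinuousLinearMap.comp π), fun m => ?_⟩
    exact congrArg κ (ε.apply_symm_apply (βQ.toMap m))
  · intro φ ψ hφ hψ
    have hD : ∀ d : D, (d : D) ∈ closure (Submodule.span R (Set.range ω.toMap) : Set D) := by
      intro d
      change W at d
      refine closure_subtype.mpr ?_
      have hd : d.1 ∈ closure (Submodule.span R (Set.range ω₀) : Set (∀ i, T i)) := d.2
      refine closure_mono ?_ hd
      have h2 : (Submodule.span R (Set.range fun m => (⟨ω₀ m, hW m⟩ : W))).map W.subtype =
          Submodule.span R (Set.range ω₀) := by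
        rw [Submodule.map_span, ← Set.range_comp]; rfl
      intro z hz
      rw [← h2] at hz
      obtain ⟨y, hy, rfl⟩ := hz
      exact ⟨y, hy, rfl⟩
    ext d
    have hsub : (Submodule.span R (Set.range ω.toMap) : Set D) ⊆ {d | φ d = ψ d} := by
      have : Submodule.span R (Set.range ω.toMap) ≤
          LinearMap.eqLocus φ.toLinearMap ψ.toLinearMap := by
        rw [Submodule.span_le]
        rintro _ ⟨m, rfl⟩
        exact (hφ m).trans (hψ m).symm
      exact this
    exact closure_minimal hsub (isClosed_eq φ.continuous ψ.continuous) (hD d)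

/-- The profinite direct sum `⊞_{u ∈ U} M_u`, chosen by its universal property. -/
noncomputable def PShf.directSum (M : PShf R) (U : Clopens M.X) : PMod R :=
  (M.exists_isDirectSum U).choose

/-- The canonical morphism `ω : p⁻¹(U) → ⊞_{u ∈ U} M_u`. -/
noncomputable def PShf.omega (M : PShf R) (U : Clopens M.X) : M.HomOver U (M.directSum U) :=
  (M.exists_isDirectSum U).choose_spec.choose

theorem PShf.isDirectSum (M : PShf R) (U : Clopens M.X) :
    M.IsDirectSum U (M.directSum U) (M.omega U) :=
  (M.exists_isDirectSum U).choose_spec.choose_spec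

/-- The map out of the profinite direct sum induced by a `sheaf' morphism. -/
noncomputable def PShf.lift (M : PShf R) {U : Clopens M.X} {P : PMod R} (β : M.HomOver U P) :
    M.directSum U →L[R] P :=
  (M.isDirectSum U P β).choose

theorem PShf.lift_omega (M : PShf R) {U : Clopens M.X} {P : PMod R} (β : M.HomOver U P)
    (m : M.Over U) : M.lift β ((M.omega U).toMap m) = β.toMap m :=
  (M.isDirectSum U P β).choose_spec.1 m

theorem PShf.directSum_ext (M : PShf R) {U : Clopens M.X} {P : PMod R}
    {φ ψ : M.directSum U →L[R] P}
    (h : ∀ m, φ ((M.omega U).toMap m) = ψ ((M.omega U).toMap m)) : φ = ψ :=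
  (M.isDirectSum U P ((M.omega U).postcomp ψ)).unique h fun _ => rfl

theorem PShf.Hom.mem_of_le {N M : PShf R} (φ : PShf.Hom N M) {V : Clopens N.X} {U : Clopens M.X}
    (h : V ≤ preim φ.base U) (m : N.Over V) : M.p (φ.map m.1) ∈ U := by
  rw [φ.comm]; exact h m.2

/-- The map `q⁻¹(V) → p⁻¹(U)` induced by a morphism `(ψ, f) : (N, q, Y) → (M, p, X)` of `sheaves'
when `V ⊆ f⁻¹(U)`. -/
def PShf.Hom.mapOver {N M : PShf R} (φ : PShf.Hom N M) {V : Clopens N.X} {U : Clopens M.X}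
    (h : V ≤ preim φ.base U) : C(N.Over V, M.Over U) where
  toFun m := ⟨φ.map m.1, φ.mem_of_le h m⟩
  continuous_toFun := (φ.map.continuous.comp continuous_subtype_val).subtype_mk _

/-- The composite of a `sheaf' morphism `M|_U → P` with the `sheaf' morphism `N|_V → M|_U` induced
by `(ψ, f) : N → M` when `V ⊆ f⁻¹(U)`. -/
def PShf.HomOver.precomp {N M : PShf R} {U : Clopens M.X} {P : PMod R} (β : M.HomOver U P)
    (φ : PShf.Hom N M) {V : Clopens N.X} (h : V ≤ preim φ.base U) : N.HomOver V P where
  toMap := β.toMap.comp (φ.mapOver h)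
  map_add y hy a b := by
    have := β.map_add _ (h hy) (Fibre.map φ.comm y a) (Fibre.map φ.comm y b)
    rw [← φ.map_add] at this
    exact this
  map_smul y hy r a := by
    have := β.map_smul _ (h hy) r (Fibre.map φ.comm y a)
    rw [← φ.map_smul] at this
    exact this

/-- The map `⊞_{y ∈ V} N_y → ⊞_{u ∈ U} M_u` induced by a morphism `(ψ, f) : N → M` of `sheaves'
and clopen sets with `V ⊆ f⁻¹(U)`. -/
noncomputable def PShf.sumHom {N M : PShf R} (φ : PShf.Hom N M) {V : Clopens N.X}
    {U : Clopens M.X} (h : V ≤ preim φ.base U) : N.directSum V →L[R] M.directSum U :=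
  N.lift ((M.omega U).precomp φ h)

theorem PShf.sumHom_omega {N M : PShf R} (φ : PShf.Hom N M) {V : Clopens N.X} {U : Clopens M.X}
    (h : V ≤ preim φ.base U) (m : N.Over V) :
    PShf.sumHom φ h ((N.omega V).toMap m) = (M.omega U).toMap (φ.mapOver h m) :=
  N.lift_omega _ m

theorem PShf.sumHom_comp {P N M : PShf R} (φ : PShf.Hom P N) (ψ : PShf.Hom N M)
    (χ : PShf.Hom P M) (hχ : ∀ m, ψ.map (φ.map m) = χ.map m) {W : Clopens P.X}
    {V : Clopens N.X} {U : Clopens M.X} (h : W ≤ preim φ.base V)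
    (k : V ≤ preim ψ.base U) (l : W ≤ preim χ.base U) (a : P.directSum W) :
    PShf.sumHom ψ k (PShf.sumHom φ h a) = PShf.sumHom χ l a := by
  have : (PShf.sumHom ψ k).comp (PShf.sumHom φ h) = PShf.sumHom χ l := by
    refine P.directSum_ext fun m => ?_
    rw [ContinuousLinearMap.comp_apply, PShf.sumHom_omega, PShf.sumHom_omega, PShf.sumHom_omega]
    exact congrArg _ (Subtype.ext (hχ m.1))
  exact congrArg (fun φ => φ a) this

theorem PShf.sumHom_id (M : PShf R) {U : Clopens M.X} (h : U ≤ preim (PShf.Hom.base (𝟙 M)) U) :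
    PShf.sumHom (𝟙 M) h = ContinuousLinearMap.id R (M.directSum U) := by
  refine M.directSum_ext fun m => ?_
  rw [PShf.sumHom_omega]
  rfl

/-- The precosheaf `U ↦ ⊞_{u ∈ U} M_u` of a `sheaf' `M`; its corestriction maps are induced by the
inclusions `p⁻¹(U) ⊆ p⁻¹(V)`. -/
noncomputable def PShf.toPreCoShf (M : PShf R) : PreCoShf R where
  X := M.X
  F :=
    { obj := fun U => M.directSum U
      map := fun {U V} h => PShf.sumHom (𝟙 M) (V := U) (U := V) h.le
      map_id := fun U => M.sumHom_id _
      map_comp := fun {U V W} h k => by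
        refine ContinuousLinearMap.ext fun a => ?_
        exact (PShf.sumHom_comp (𝟙 M) (𝟙 M) (𝟙 M) (fun _ => rfl) h.le k.le (h ≫ k).le a).symm }

/-- The morphism of precosheaves `(Ψ, f)` induced by a morphism `(ψ, f)` of `sheaves'. -/
noncomputable def PShf.Hom.toPreCoShf {N M : PShf R} (φ : PShf.Hom N M) :
    PreCoShf.Hom N.toPreCoShf M.toPreCoShf where
  base := φ.base
  app U V := PShf.sumHom (V := preim φ.base U ⊓ V) φ inf_le_left
  naturality {U U' V V'} hU hV a := by
    have h1 := PShf.sumHom_comp (𝟙 N) φ φ (fun _ => rfl) (V := preim φ.base U' ⊓ V') (U := U')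
      (W := preim φ.base U ⊓ V) (inf_le_inf (preim_mono _ hU) hV) inf_le_left
      (inf_le_left.trans (preim_mono _ hU)) a
    have h2 := PShf.sumHom_comp φ (𝟙 M) φ (fun _ => rfl) (V := U) (U := U')
      (W := preim φ.base U ⊓ V) inf_le_left hU (inf_le_left.trans (preim_mono _ hU)) a
    exact h1.trans h2.symm

variable (R) in
/-- The functor `CoShf`, with values in precosheaves: `CoShf(M)(U) = ⊞_{u ∈ U} M_u`, and a morphism
`(ψ, f) : N → M` is sent to `(Ψ, f)` with
`Ψ_{U,V} : ⊞_{y ∈ f⁻¹(U) ∩ V} N_y → ⊞_{u ∈ U} M_u` induced by `ψ`. -/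
noncomputable def coShf : PShf R ⥤ PreCoShf R where
  obj M := M.toPreCoShf
  map φ := PShf.Hom.toPreCoShf φ
  map_id M := by
    refine PreCoShf.Hom.ext' rfl fun U V hle a => ?_
    have hU : preim (ContinuousMap.id M.X) U ⊓ V ≤ U := inf_le_left.trans (preim_id U).le
    exact PShf.sumHom_comp (𝟙 M) (𝟙 M) (𝟙 M) (fun _ => rfl) hle hU hU a
  map_comp {P N M} φ ψ := by
    refine PreCoShf.Hom.ext' rfl fun U V hle a => ?_
    let Φ : PShf.Hom P N := φ
    let Ψ : PShf.Hom N M := ψ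
    have h0 : preim (Ψ.base.comp Φ.base) U ⊓ V ≤ preim Φ.base (preim Ψ.base U) ⊓ V := fun _ h => h
    have h1 : preim (Ψ.base.comp Φ.base) U ⊓ V ≤ preim Φ.base (preim Ψ.base U) := fun _ h => h.1
    have h2 : preim (Ψ.base.comp Φ.base) U ⊓ V ≤ preim Φ.base (preim Ψ.base U ⊓ ⊤) :=
      fun _ h => ⟨h.1, trivial⟩
    have e1 := PShf.sumHom_comp (𝟙 P) (𝟙 P) (𝟙 P) (fun _ => rfl)
      (V := preim (Ψ.base.comp Φ.base) U ⊓ V) (U := preim Φ.base (preim Ψ.base U) ⊓ V)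
      (W := preim (Ψ.base.comp Φ.base) U ⊓ V) hle h0 h0 a
    have e2 := PShf.sumHom_comp (𝟙 P) Φ Φ (fun _ => rfl)
      (V := preim Φ.base (preim Ψ.base U) ⊓ V) (U := preim Ψ.base U)
      (W := preim (Ψ.base.comp Φ.base) U ⊓ V) h0 inf_le_left h1 a
    have e3 := PShf.sumHom_comp Φ (𝟙 N) Φ (fun _ => rfl)
      (V := preim Ψ.base U) (U := preim Ψ.base U ⊓ ⊤)
      (W := preim (Ψ.base.comp Φ.base) U ⊓ V) h1 (le_inf le_rfl le_top) h2 a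
    have e4 := PShf.sumHom_comp Φ Ψ (φ ≫ ψ) (fun _ => rfl)
      (V := preim Ψ.base U ⊓ ⊤) (U := U)
      (W := preim (Ψ.base.comp Φ.base) U ⊓ V) h2 inf_le_left inf_le_left a
    rw [← e3, ← e2, ← e1] at e4
    exact e4


/-! ### Stalks and the co-étale construction -/

/-- The stalk `M_x = lim M(U)`, the inverse limit over the clopen sets `U` containing `x`. -/
def PreCoShf.stalk (M : PreCoShf R) (x : M.X) :
    Submodule R (∀ U : {U : Clopens M.X // x ∈ U}, M.F.obj U.1) where
  carrier := {s | ∀ (U V : {U : Clopens M.X // x ∈ U}) (h : U.1 ≤ V.1), M.cor h (s U) = s V}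
  add_mem' {a b} ha hb U V h := by
    simp only [Pi.add_apply, map_add, ha U V h, hb U V h]
  zero_mem' U V h := by simp only [Pi.zero_apply, map_zero]
  smul_mem' r a ha U V h := by simp only [Pi.smul_apply, map_smul, ha U V h]

/-- The disjoint union of the stalks of a precosheaf. -/
structure PreCoShf.Total (M : PreCoShf R) : Type u where
  pt : M.X
  val : M.stalk pt

/-- The sub-basic set `O_{U,W}` of all `(m, x)` such that `x ∈ U` and `cor_x^U(m) ∈ W`. -/
def PreCoShf.basicOpen (M : PreCoShf R) (U : Clopens M.X) (W : Set (M.F.obj U)) : Set M.Total :=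
  {m | ∃ h : m.pt ∈ U, m.val.1 ⟨U, h⟩ ∈ W}

/-- The topology generated by the sets `O_{U,W}` with `U` clopen and `W ⊆ M(U)` open. -/
instance (M : PreCoShf R) : TopologicalSpace M.Total :=
  TopologicalSpace.generateFrom
    {O | ∃ (U : Clopens M.X) (W : Set (M.F.obj U)), IsOpen W ∧ O = M.basicOpen U W}

theorem PreCoShf.isOpen_basicOpen (M : PreCoShf R) (U : Clopens M.X) {W : Set (M.F.obj U)}
    (hW : IsOpen W) : IsOpen (M.basicOpen U W) :=
  TopologicalSpace.isOpen_generateFrom_of_mem ⟨U, W, hW, rfl⟩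

open scoped Classical in
/-- The component at `U` of the embedding `i`: `cor_x^U(m)` if `x ∈ U`, and `0` otherwise. -/
noncomputable def PreCoShf.ev (M : PreCoShf R) (U : Clopens M.X) (m : M.Total) : M.F.obj U :=
  if h : m.pt ∈ U then m.val.1 ⟨U, h⟩ else 0

theorem PreCoShf.ev_of_mem (M : PreCoShf R) {U : Clopens M.X} {m : M.Total} (h : m.pt ∈ U) :
    M.ev U m = m.val.1 ⟨U, h⟩ := dif_pos h

theorem PreCoShf.ev_of_notMem (M : PreCoShf R) {U : Clopens M.X} {m : M.Total} (h : m.pt ∉ U) :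
    M.ev U m = 0 := dif_neg h

/-- The embedding `i` of the disjoint union of the stalks into `∏_U M(U) × X`. -/
noncomputable def PreCoShf.emb (M : PreCoShf R) (m : M.Total) : (∀ U, M.F.obj U) × M.X :=
  (fun U => M.ev U m, m.pt)

theorem PreCoShf.emb_injective (M : PreCoShf R) : Function.Injective M.emb := by
  rintro ⟨x, s⟩ ⟨y, t⟩ h
  obtain rfl : x = y := congrArg Prod.snd h
  congr 1
  refine Subtype.ext (funext fun U => ?_)
  have := congrFun (congrArg Prod.fst h) U.1
  change M.ev U.1 ⟨x, s⟩ = M.ev U.1 ⟨x, t⟩ at this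
  rwa [M.ev_of_mem (m := ⟨x, s⟩) U.2, M.ev_of_mem (m := ⟨x, t⟩) U.2] at this

theorem PreCoShf.continuous_pt (M : PreCoShf R) : Continuous (PreCoShf.Total.pt (M := M)) := by
  refine (isTopologicalBasis_isClopen (X := M.X)).continuous_iff.mpr fun U hU => ?_
  convert M.isOpen_basicOpen ⟨U, hU⟩ isOpen_univ using 1
  ext m
  exact ⟨fun h => ⟨h, trivial⟩, fun h => h.1⟩

theorem PreCoShf.isInducing_emb (M : PreCoShf R) : Topology.IsInducing M.emb := by
  refine ⟨le_antisymm ?_ (le_generateFrom ?_)⟩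
  · refine continuous_iff_le_induced.mp (Continuous.prodMk (continuous_pi fun U => ?_)
      M.continuous_pt)
    refine continuous_def.mpr fun W hW => ?_
    by_cases h0 : (0 : M.F.obj U) ∈ W
    · convert (M.isOpen_basicOpen U hW).union (M.isOpen_basicOpen Uᶜ isOpen_univ) using 1
      ext m
      by_cases h : m.pt ∈ U
      · have h' : m.pt ∉ Uᶜ := fun h' => h' h
        simp [PreCoShf.basicOpen, M.ev_of_mem h, h, h']
      · have h' : m.pt ∈ Uᶜ := h
        simp [PreCoShf.basicOpen, M.ev_of_notMem h, h, h', h0]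
    · convert M.isOpen_basicOpen U hW using 1
      ext m
      by_cases h : m.pt ∈ U
      · simp [PreCoShf.basicOpen, M.ev_of_mem h, h]
      · simp [PreCoShf.basicOpen, M.ev_of_notMem h, h, h0]
  · rintro _ ⟨U, W, hW, rfl⟩
    refine isOpen_induced_iff.mpr ⟨{z | z.2 ∈ U ∧ z.1 U ∈ W}, ?_, ?_⟩
    · exact (U.isOpen.preimage continuous_snd).inter
        (hW.preimage ((continuous_apply U).comp continuous_fst))
    · ext m
      constructor
      · rintro ⟨h, h'⟩
        refine ⟨h, ?_⟩
        rw [← M.ev_of_mem h]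
        exact h'
      · rintro ⟨h, h'⟩
        refine ⟨h, ?_⟩
        change M.ev U m ∈ W
        rwa [M.ev_of_mem h]

theorem PreCoShf.range_emb (M : PreCoShf R) : Set.range M.emb =
    (⋂ U : Clopens M.X, {z | z.2 ∈ U ∨ z.1 U = 0}) ∩
      ⋂ (U : Clopens M.X) (V : Clopens M.X) (h : U ≤ V), {z | z.2 ∉ U ∨ M.cor h (z.1 U) = z.1 V} := by
  ext ⟨s, x⟩
  simp only [Set.mem_range, Set.mem_inter_iff, Set.mem_iInter, Set.mem_ofPred_eq]
  constructor
  · rintro ⟨m, hm⟩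
    obtain rfl : m.pt = x := congrArg Prod.snd hm
    obtain rfl : (fun U => M.ev U m) = s := congrArg Prod.fst hm
    refine ⟨fun U => ?_, fun U V h => ?_⟩
    · by_cases hU : m.pt ∈ U
      · exact Or.inl hU
      · exact Or.inr (M.ev_of_notMem hU)
    · by_cases hU : m.pt ∈ U
      · right
        change M.cor h (M.ev U m) = M.ev V m
        rw [M.ev_of_mem hU, M.ev_of_mem (h hU)]
        exact m.val.2 ⟨U, hU⟩ ⟨V, h hU⟩ h
      · exact Or.inl hU
  · rintro ⟨h1, h2⟩
    let m : M.Total := ⟨x, ⟨fun U => s U.1, fun U V h => (h2 U.1 V.1 h).resolve_left (not_not.mpr U.2)⟩⟩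
    refine ⟨m, Prod.ext (funext fun U => ?_) rfl⟩
    by_cases hU : x ∈ U
    · exact M.ev_of_mem (m := m) hU
    · exact (M.ev_of_notMem (m := m) hU).trans ((h1 U).resolve_left hU).symm

theorem PreCoShf.isClosedEmbedding_emb (M : PreCoShf R) : Topology.IsClosedEmbedding M.emb := by
  refine ⟨⟨M.isInducing_emb, M.emb_injective⟩, ?_⟩
  rw [M.range_emb]
  refine (isClosed_iInter fun U => ?_).inter
    (isClosed_iInter fun U => isClosed_iInter fun V => isClosed_iInter fun h => ?_)
  · exact (U.isClosed.preimage continuous_snd).union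
      (isClosed_singleton.preimage ((continuous_apply U).comp continuous_fst))
  · exact (U.isOpen.isClosed_compl.preimage continuous_snd).union
      (isClosed_eq ((M.cor h).continuous.comp ((continuous_apply U).comp continuous_fst))
        ((continuous_apply V).comp continuous_fst))

instance (M : PreCoShf R) : CompactSpace M.Total := M.isClosedEmbedding_emb.compactSpace

instance (M : PreCoShf R) : T2Space M.Total := M.isClosedEmbedding_emb.isEmbedding.t2Space

instance (M : PreCoShf R) : TotallyDisconnectedSpace M.Total :=
  M.isClosedEmbedding_emb.isEmbedding.isTotallyDisconnected_range.mp
    (isTotallyDisconnected_of_totallyDisconnectedSpace _)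

/-- The fibre of `⨆_x M_x → X` over `x` is the stalk `M_x`. -/
def PreCoShf.fibreEquiv (M : PreCoShf R) (x : M.X) :
    Fibre (PreCoShf.Total.pt (M := M)) x ≃ M.stalk x where
  toFun m := m.2 ▸ m.1.val
  invFun s := ⟨⟨x, s⟩, rfl⟩
  left_inv := by rintro ⟨⟨y, s⟩, rfl⟩; rfl
  right_inv _ := rfl

instance (M : PreCoShf R) (x : M.X) : AddCommGroup (Fibre (PreCoShf.Total.pt (M := M)) x) :=
  (M.fibreEquiv x).addCommGroup

instance (M : PreCoShf R) (x : M.X) : Module R (Fibre (PreCoShf.Total.pt (M := M)) x) :=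
  (M.fibreEquiv x).module R

theorem PreCoShf.fibreEquiv_add (M : PreCoShf R) (x : M.X)
    (a b : Fibre (PreCoShf.Total.pt (M := M)) x) :
    M.fibreEquiv x (a + b) = M.fibreEquiv x a + M.fibreEquiv x b :=
  (M.fibreEquiv x).apply_symm_apply _

theorem PreCoShf.fibreEquiv_smul (M : PreCoShf R) (x : M.X) (r : R)
    (a : Fibre (PreCoShf.Total.pt (M := M)) x) :
    M.fibreEquiv x (r • a) = r • M.fibreEquiv x a :=
  (M.fibreEquiv x).apply_symm_apply _

theorem PreCoShf.ev_fibre (M : PreCoShf R) {U : Clopens M.X} {x : M.X} (h : x ∈ U)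
    (a : Fibre (PreCoShf.Total.pt (M := M)) x) :
    M.ev U a.1 = (M.fibreEquiv x a).1 ⟨U, h⟩ := by
  obtain ⟨⟨y, s⟩, rfl⟩ := a
  exact M.ev_of_mem (m := ⟨y, s⟩) h

theorem PreCoShf.ev_add (M : PreCoShf R) (U : Clopens M.X) (x : M.X)
    (a b : Fibre (PreCoShf.Total.pt (M := M)) x) : M.ev U (a + b).1 = M.ev U a.1 + M.ev U b.1 := by
  by_cases h : x ∈ U
  · rw [M.ev_fibre h, M.ev_fibre h, M.ev_fibre h, M.fibreEquiv_add]; rfl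
  · have h' : ∀ c : Fibre (PreCoShf.Total.pt (M := M)) x, c.1.pt ∉ U := fun c => c.2.symm ▸ h
    rw [M.ev_of_notMem (h' _), M.ev_of_notMem (h' _), M.ev_of_notMem (h' _), add_zero]

theorem PreCoShf.ev_smul (M : PreCoShf R) (U : Clopens M.X) (x : M.X) (r : R)
    (a : Fibre (PreCoShf.Total.pt (M := M)) x) : M.ev U (r • a).1 = r • M.ev U a.1 := by
  by_cases h : x ∈ U
  · rw [M.ev_fibre h, M.ev_fibre h, M.fibreEquiv_smul]; rfl
  · have h' : ∀ c : Fibre (PreCoShf.Total.pt (M := M)) x, c.1.pt ∉ U := fun c => c.2.symm ▸ h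
    rw [M.ev_of_notMem (h' _), M.ev_of_notMem (h' _), smul_zero]

theorem PreCoShf.continuous_ev (M : PreCoShf R) (U : Clopens M.X) : Continuous (M.ev U) :=
  (continuous_apply U).comp (continuous_fst.comp M.isInducing_emb.continuous)

/-- The `sheaf' `⨆_x M_x → X` of the stalks of a precosheaf. -/
noncomputable def PreCoShf.toPShf (M : PreCoShf R) : PShf R where
  X := M.X
  total := Profinite.of M.Total
  p := ⟨PreCoShf.Total.pt, M.continuous_pt⟩
  surjective x := ⟨⟨x, 0⟩, rfl⟩
  addCommGroup x := inferInstanceAs (AddCommGroup (Fibre (PreCoShf.Total.pt (M := M)) x))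
  module x := inferInstanceAs (Module R (Fibre (PreCoShf.Total.pt (M := M)) x))
  continuous_smul := by
    refine M.isInducing_emb.continuous_iff.mpr (Continuous.prodMk (continuous_pi fun U => ?_) ?_)
    · refine (continuous_fst.smul ((M.continuous_ev U).comp continuous_snd)).congr fun z => ?_
      exact (M.ev_smul U z.2.pt z.1 ⟨z.2, rfl⟩).symm
    · refine (M.continuous_pt.comp continuous_snd).congr fun z => ?_
      exact (z.1 • (⟨z.2, rfl⟩ : Fibre (PreCoShf.Total.pt (M := M)) z.2.pt)).2.symm
  continuous_add := by
    refine M.isInducing_emb.continuous_iff.mpr (Continuous.prodMk (continuous_pi fun U => ?_) ?_)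
    · refine (((M.continuous_ev U).comp (continuous_fst.comp continuous_subtype_val)).add
        ((M.continuous_ev U).comp (continuous_snd.comp continuous_subtype_val))).congr fun z => ?_
      exact (M.ev_add U z.1.2.pt ⟨z.1.1, z.2⟩ ⟨z.1.2, rfl⟩).symm
    · refine (M.continuous_pt.comp (continuous_snd.comp continuous_subtype_val)).congr fun z => ?_
      exact ((⟨z.1.1, z.2⟩ : Fibre (PreCoShf.Total.pt (M := M)) z.1.2.pt) + ⟨z.1.2, rfl⟩).2.symm

theorem mem_preim_inf_top {Y X : Type u} [TopologicalSpace Y] [TopologicalSpace X] {f : C(Y, X)}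
    {U : Clopens X} {y : Y} (h : f y ∈ U) : y ∈ preim f U ⊓ ⊤ :=
  ⟨h, trivial⟩

/-- The map `N_y → M_{f(y)}` on stalks induced by a morphism `(Ψ, f) : (N, Y) → (M, X)`, with
components `N_y → N(f⁻¹(U)) = N(f⁻¹(U) ∩ Y) → M(U)`, the last map being `Ψ_{U,Y}`. -/
def PreCoShf.Hom.stalkMap {N M : PreCoShf R} (Ψ : PreCoShf.Hom N M) (y : N.X) :
    N.stalk y →ₗ[R] M.stalk (Ψ.base y) where
  toFun s := ⟨fun U => Ψ.app U.1 ⊤ (s.1 ⟨preim Ψ.base U.1 ⊓ ⊤, mem_preim_inf_top U.2⟩), fun U V h =>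
    (Ψ.naturality h le_rfl _).symm.trans (congrArg (Ψ.app V.1 ⊤)
      (s.2 ⟨_, mem_preim_inf_top U.2⟩ ⟨_, mem_preim_inf_top V.2⟩
        (inf_le_inf (preim_mono _ h) le_rfl)))⟩
  map_add' _ _ := Subtype.ext (funext fun U => map_add (Ψ.app U.1 ⊤) _ _)
  map_smul' _ _ := Subtype.ext (funext fun U => map_smul (Ψ.app U.1 ⊤) _ _)

/-- The map `ψ` of total spaces induced by a morphism of precosheaves. -/
def PreCoShf.Hom.totalMap {N M : PreCoShf R} (Ψ : PreCoShf.Hom N M) (n : N.Total) : M.Total :=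
  ⟨Ψ.base n.pt, Ψ.stalkMap n.pt n.val⟩

theorem PreCoShf.Hom.continuous_totalMap {N M : PreCoShf R} (Ψ : PreCoShf.Hom N M) :
    Continuous Ψ.totalMap := by
  refine continuous_generateFrom_iff.mpr ?_
  rintro _ ⟨U, W, hW, rfl⟩
  convert N.isOpen_basicOpen (preim Ψ.base U ⊓ ⊤) (hW.preimage (Ψ.app U ⊤).continuous) using 1
  ext n
  exact ⟨fun h => ⟨⟨h.1, trivial⟩, h.2⟩, fun h => ⟨h.1.1, h.2⟩⟩

theorem PreCoShf.Hom.fibreEquiv_map {N M : PreCoShf R} (Ψ : PreCoShf.Hom N M) (y : N.X)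
    (a : Fibre (PreCoShf.Total.pt (M := N)) y) :
    M.fibreEquiv (Ψ.base y) (Fibre.map (ψ := Ψ.totalMap) (f := Ψ.base) (fun _ => rfl) y a) =
      Ψ.stalkMap y (N.fibreEquiv y a) := by
  obtain ⟨⟨y, s⟩, rfl⟩ := a
  rfl

/-- The morphism of `sheaves' of stalks induced by a morphism of precosheaves. -/
noncomputable def PreCoShf.Hom.toPShf {N M : PreCoShf R} (Ψ : PreCoShf.Hom N M) :
    PShf.Hom N.toPShf M.toPShf where
  base := Ψ.base
  map := ⟨Ψ.totalMap, Ψ.continuous_totalMap⟩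
  comm _ := rfl
  map_add y a b := by
    refine (M.fibreEquiv (Ψ.base y)).injective ?_
    refine (Ψ.fibreEquiv_map y (a + b)).trans ?_
    refine ((congrArg (Ψ.stalkMap y) (N.fibreEquiv_add y a b)).trans
      (map_add (Ψ.stalkMap y) _ _)).trans ?_
    refine Eq.trans ?_ (M.fibreEquiv_add _ _ _).symm
    exact congrArg₂ (· + ·) (Ψ.fibreEquiv_map y a).symm (Ψ.fibreEquiv_map y b).symm
  map_smul y r a := by
    refine (M.fibreEquiv (Ψ.base y)).injective ?_
    refine (Ψ.fibreEquiv_map y (r • a)).trans ?_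
    refine ((congrArg (Ψ.stalkMap y) (N.fibreEquiv_smul y r a)).trans
      (map_smul (Ψ.stalkMap y) _ _)).trans ?_
    refine Eq.trans ?_ (M.fibreEquiv_smul _ _ _).symm
    exact congrArg (r • ·) (Ψ.fibreEquiv_map y a).symm

variable (R) in
/-- The co-étale construction, on all precosheaves. -/
noncomputable def preCoEtale : PreCoShf R ⥤ PShf R where
  obj M := M.toPShf
  map Ψ := PreCoShf.Hom.toPShf Ψ
  map_id M := by
    refine PShf.Hom.ext' rfl (ContinuousMap.ext fun m => ?_)
    obtain ⟨x, s⟩ := m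
    refine congrArg (PreCoShf.Total.mk (M := M) x) (Subtype.ext (funext fun U => ?_))
    exact s.2 ⟨_, _⟩ U _
  map_comp {P N M} Φ Ψ := by
    refine PShf.Hom.ext' rfl (ContinuousMap.ext fun m => ?_)
    obtain ⟨z, s⟩ := m
    refine congrArg (PreCoShf.Total.mk (M := M) _) (Subtype.ext (funext fun U => ?_))
    refine congrArg (PreCoShf.Hom.app Ψ U.1 ⊤) ?_
    have h0 : preim Ψ.base U.1 ≤ preim Ψ.base U.1 ⊓ ⊤ := le_inf le_rfl le_top
    refine (Φ.naturality h0 (le_refl ⊤) _).symm.trans (congrArg (Φ.app _ ⊤) ?_)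
    exact (P.cor_cor _ _ _).trans (s.2 ⟨_, _⟩ ⟨_, _⟩ _)

variable (R) in
/-- The functor `CoÉtale` from cosheaves to `sheaves' of profinite modules: the disjoint union of the
stalks `M_x = lim_{U ∋ x} M(U)`, with the topology generated by the sets `O_{U,W}`. -/
noncomputable def coEtale : CoShf R ⥤ PShf R :=
  (isCosheaf R).ι ⋙ preCoEtale R

end

end ProfSheaf

/-! The equivalence is witnessed by two natural maps. A point `m` of a `sheaf' over `x` gives the
compatible family of its images in `⊞_{u ∈ U} M_u` for `U ∋ x` (`PShf.germ`), and evaluation of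
stalks at `U` induces `⊞_{u ∈ U} M_u → M(U)` for a cosheaf (`PreCoShf.sumEv`). All spaces are
compact Hausdorff, so bijectivity suffices for both to be isomorphisms.

Since `R` is compact, a closed submodule and a point outside it are separated by an open submodule
`K` (`exists_isOpen_submodule_of_notMem`). This turns each bijectivity statement into a condition
modulo `K`, which can be checked locally on `X`.

That `U ↦ ⊞_{u ∈ U} M_u` is a cosheaf follows from a contracting homotopy: refine the family to
disjoint clopen sets `D_i ≤ U_i` and project to the summands over `D_i`
(`PShf.isCosheaf_toPreCoShf`).

For a `sheaf', a homomorphism from a fibre to a finite module extends over a clopen neighbourhood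
(`PShf.exists_homOver_extending`), so direct sums separate points of the fibre. Conversely, a stalk
element of the direct sums has each component in the image of the fibre, because near `x` all
summands map into any open submodule containing that image; compactness then supplies one preimage
for all `U` (`PShf.exists_fibreOmega_eq`).

For a cosheaf, the properties "everything over `V` lands in `K`" and "every kernel element over `V`
lands in `K`" pass to smaller clopen sets and to disjoint unions, so they hold globally once they
hold locally (`clopens_induction`). If one fails near `x` on every neighbourhood, compactness
assembles the counterexamples into a stalk element (`PreCoShf.exists_stalk_mem`), which contradicts
what is known on stalks. -/

namespace ProfSheaf

variable {R : Type u} [Ring R] [TopologicalSpace R]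

/-! ### Open submodules -/

/-- In a profinite module over a compact ring the open submodules form a base at zero. -/
theorem exists_isOpen_submodule_subset [CompactSpace R] {P : Type*} [AddCommGroup P] [Module R P]
    [TopologicalSpace P] [IsTopologicalAddGroup P] [ContinuousSMul R P] [CompactSpace P]
    [T2Space P] [TotallyDisconnectedSpace P] {W : Set P} (hW : W ∈ nhds 0) :
    ∃ K : Submodule R P, IsOpen (K : Set P) ∧ (K : Set P) ⊆ W := by
  obtain ⟨O, hOW, hO, h0⟩ := mem_nhds_iff.mp hW
  obtain ⟨H, hH⟩ := ProfiniteGrp.exist_openNormalAddSubgroup_sub_open_nhds_of_zero hO h0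
  -- The largest submodule contained in the open subgroup `H`.
  let K : Submodule R P :=
    { carrier := {m | ∀ r : R, r • m ∈ H.toAddSubgroup}
      add_mem' := fun ha hb r => by rw [smul_add]; exact add_mem (ha r) (hb r)
      zero_mem' := fun r => by rw [smul_zero]; exact zero_mem _
      smul_mem' := fun c m hm r => by rw [smul_smul]; exact hm _ }
  have hKH : ∀ m ∈ K, m ∈ H.toAddSubgroup := fun m hm => by
    have := hm 1
    rwa [one_smul] at this
  refine ⟨K, ?_, fun m hm => hOW (hH (hKH m hm))⟩
  -- The complement of `K` is the projection along the compact factor `R` of the closed set where `r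
  -- • m ∉ H`; hence `K` is open.
  have hc : IsClosed (Prod.snd '' {z : R × P | z.1 • z.2 ∉ H.toAddSubgroup}) :=
    isClosedMap_snd_of_compactSpace _
      ((H.isOpen'.preimage (continuous_fst.smul continuous_snd)).isClosed_compl)
  convert hc.isOpen_compl using 1
  ext m
  simp [K]

/-- A closed submodule of a profinite module and a point outside it are separated by an open
submodule. -/
theorem exists_isOpen_submodule_of_notMem [CompactSpace R] {P : Type*} [AddCommGroup P]
    [Module R P] [TopologicalSpace P] [IsTopologicalAddGroup P] [ContinuousSMul R P]
    [CompactSpace P] [T2Space P] [TotallyDisconnectedSpace P] {B : Submodule R P}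
    (hB : IsClosed (B : Set P)) {s : P} (hs : s ∉ B) :
    ∃ K : Submodule R P, IsOpen (K : Set P) ∧ IsClosed (K : Set P) ∧ B ≤ K ∧ s ∉ K := by
  -- If `K` lies in this neighbourhood then `s ∉ B ⊔ K`: from `s = b + k` would follow `s + (-k) ∈
  -- B`. An overgroup of an open subgroup is open, hence closed.
  have hW : {d : P | s + d ∉ B} ∈ nhds (0 : P) :=
    (hB.isOpen_compl.preimage (continuous_const.add continuous_id)).mem_nhds
      (by simpa using hs)
  obtain ⟨K, hK, hKW⟩ := exists_isOpen_submodule_subset (R := R) hW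
  have ho : IsOpen ((B ⊔ K : Submodule R P) : Set P) :=
    AddSubgroup.isOpen_mono (H₁ := K.toAddSubgroup) (H₂ := (B ⊔ K).toAddSubgroup)
      (show K ≤ B ⊔ K from le_sup_right) hK
  refine ⟨B ⊔ K, ho, AddSubgroup.isClosed_of_isOpen (B ⊔ K).toAddSubgroup ho, le_sup_left,
    fun h => ?_⟩
  obtain ⟨b, hb, k, hk, rfl⟩ := Submodule.mem_sup.mp h
  exact hKW (neg_mem hk) (by simpa using hb)

/-! ### Exactness of the precosheaf of profinite direct sums -/

open scoped Classical in
/-- The `sheaf' morphism on `E` that equals `β` over `D` and vanishes elsewhere. -/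
noncomputable def PShf.HomOver.cutOff {M : PShf R} {V : Clopens M.X} {P : PMod R}
    (β : M.HomOver V P) (E D : Clopens M.X) (h : E ⊓ D ≤ V) : M.HomOver E P where
  toMap :=
    { toFun := fun m => if hm : M.p m.1 ∈ D then β.toMap ⟨m.1, h ⟨m.2, hm⟩⟩ else 0
      continuous_toFun := by
        -- Since `D` is clopen, continuity can be checked separately on the part over `D` and on its
        -- complement.
        have hcl : IsClopen {m : M.Over E | M.p m.1 ∈ D} :=
          D.isClopen.preimage (M.p.continuous.comp continuous_subtype_val)
        refine continuous_iff_continuousAt.mpr fun m => ?_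
        by_cases hm : M.p m.1 ∈ D
        · refine ContinuousOn.continuousAt (s := {m : M.Over E | M.p m.1 ∈ D}) ?_
            (hcl.isOpen.mem_nhds hm)
          refine continuousOn_iff_continuous_domRestrict.mpr ?_
          have : Continuous fun z : {m : M.Over E | M.p m.1 ∈ D} =>
              β.toMap ⟨z.1.1, h ⟨z.1.2, z.2⟩⟩ :=
            β.toMap.continuous.comp
              ((continuous_subtype_val.comp continuous_subtype_val).subtype_mk _)
          refine this.congr fun z => Eq.symm ?_
          exact (dif_pos z.2 : (if hm : M.p z.1.1 ∈ D then β.toMap ⟨z.1.1, h ⟨z.1.2, hm⟩⟩ else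
            (0 : P)) = _)
        · refine (continuousAt_const (y := (0 : P))).congr ?_
          filter_upwards [hcl.compl.isOpen.mem_nhds hm] with z hz
          refine Eq.symm ?_
          exact (dif_neg hz : (if hm : M.p z.1 ∈ D then β.toMap ⟨z.1, h ⟨z.2, hm⟩⟩ else
            (0 : P)) = _) }
  map_add x hx a b := by
    have key : ∀ c : Fibre M.p x, M.p (M.toOver hx c).1 = x := fun c => c.2
    by_cases hD : x ∈ D
    · have h' : ∀ c : Fibre M.p x, M.p (M.toOver hx c).1 ∈ D := fun c => by rwa [key]
      simp only [ContinuousMap.coe_mk, dif_pos (h' _)]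
      exact β.map_add x (h ⟨hx, hD⟩) a b
    · have h' : ∀ c : Fibre M.p x, M.p (M.toOver hx c).1 ∉ D := fun c => by rwa [key]
      simp only [ContinuousMap.coe_mk, dif_neg (h' _), add_zero]
  map_smul x hx r a := by
    have key : ∀ c : Fibre M.p x, M.p (M.toOver hx c).1 = x := fun c => c.2
    by_cases hD : x ∈ D
    · have h' : ∀ c : Fibre M.p x, M.p (M.toOver hx c).1 ∈ D := fun c => by rwa [key]
      simp only [ContinuousMap.coe_mk, dif_pos (h' _)]
      exact β.map_smul x (h ⟨hx, hD⟩) r a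
    · have h' : ∀ c : Fibre M.p x, M.p (M.toOver hx c).1 ∉ D := fun c => by rwa [key]
      simp only [ContinuousMap.coe_mk, dif_neg (h' _), smul_zero]

/-- The map `⊞_{u ∈ E} M_u → ⊞_{u ∈ V} M_u` that projects to the summands over `D`. -/
noncomputable def PShf.transfer (M : PShf R) (E D V : Clopens M.X) (h : E ⊓ D ≤ V) :
    M.directSum E →L[R] M.directSum V :=
  M.lift ((M.omega V).cutOff E D h)

theorem PShf.transfer_omega_of_mem (M : PShf R) {E D V : Clopens M.X} (h : E ⊓ D ≤ V)
    (m : M.Over E) (hm : M.p m.1 ∈ D) :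
    M.transfer E D V h ((M.omega E).toMap m) = (M.omega V).toMap ⟨m.1, h ⟨m.2, hm⟩⟩ :=
  (M.lift_omega _ m).trans (dif_pos hm)

theorem PShf.transfer_omega_of_notMem (M : PShf R) {E D V : Clopens M.X} (h : E ⊓ D ≤ V)
    (m : M.Over E) (hm : M.p m.1 ∉ D) :
    M.transfer E D V h ((M.omega E).toMap m) = 0 :=
  (M.lift_omega _ m).trans (dif_neg hm)

/-- The map `⊞_{u ∈ U} M_u → ⊞_{u ∈ V} M_u` for `U ≤ V`. -/
noncomputable def PShf.cor (M : PShf R) {U V : Clopens M.X} (h : U ≤ V) :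
    M.directSum U →L[R] M.directSum V :=
  M.toPreCoShf.cor h

theorem PShf.cor_self (M : PShf R) {U : Clopens M.X} (h : U ≤ U) (a : M.directSum U) :
    M.cor h a = a :=
  M.toPreCoShf.cor_self h a

theorem PShf.cor_omega (M : PShf R) {U V : Clopens M.X} (h : U ≤ V) (m : M.Over U) :
    M.cor h ((M.omega U).toMap m) = (M.omega V).toMap ⟨m.1, h m.2⟩ :=
  PShf.sumHom_omega (𝟙 M) (V := U) (U := V) h m

/-- Corestriction after a transfer is a transfer. -/
theorem PShf.cor_transfer (M : PShf R) {E D V W : Clopens M.X} (h : E ⊓ D ≤ V) (k : V ≤ W)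
    (a : M.directSum E) :
    M.cor k (M.transfer E D V h a) = M.transfer E D W (h.trans k) a := by
  have : ContinuousLinearMap.comp (M.cor k)
      (M.transfer E D V h) = M.transfer E D W (h.trans k) := by
    refine M.directSum_ext fun m => ?_
    rw [ContinuousLinearMap.comp_apply]
    by_cases hm : M.p m.1 ∈ D
    · rw [M.transfer_omega_of_mem h m hm, M.transfer_omega_of_mem _ m hm, M.cor_omega]
    · rw [M.transfer_omega_of_notMem h m hm, M.transfer_omega_of_notMem _ m hm, map_zero]
  exact congrArg (fun φ => φ a) this

/-- A transfer after a corestriction is a transfer. -/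
theorem PShf.transfer_cor (M : PShf R) {E' E D V : Clopens M.X} (h : E ⊓ D ≤ V) (k : E' ≤ E)
    (a : M.directSum E') :
    M.transfer E D V h (M.cor k a) =
      M.transfer E' D V ((inf_le_inf_right D k).trans h) a := by
  have : ContinuousLinearMap.comp (M.transfer E D V h)
      (M.cor k) =
      M.transfer E' D V ((inf_le_inf_right D k).trans h) := by
    refine M.directSum_ext fun m => ?_
    rw [ContinuousLinearMap.comp_apply, M.cor_omega]
    by_cases hm : M.p m.1 ∈ D
    · rw [M.transfer_omega_of_mem h _ hm, M.transfer_omega_of_mem _ m hm]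
    · rw [M.transfer_omega_of_notMem h _ hm, M.transfer_omega_of_notMem _ m hm]
  exact congrArg (fun φ => φ a) this

/-- Projecting to the pieces of a partition and adding up is the corestriction. -/
theorem PShf.sum_transfer (M : PShf R) {E V : Clopens M.X} (hEV : E ≤ V) {ι : Type*} [Fintype ι]
    (D : ι → Clopens M.X) (hD : ∀ x ∈ E, ∃! i, x ∈ D i) (a : M.directSum E) :
    ∑ i, M.transfer E (D i) V (inf_le_left.trans hEV) a = M.cor hEV a := by
  have : ∑ i, M.transfer E (D i) V (inf_le_left.trans hEV) =
      M.cor hEV := by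
    refine M.directSum_ext fun m => ?_
    obtain ⟨i, hi, huniq⟩ := hD _ m.2
    rw [sum_apply, Finset.sum_eq_single i, M.transfer_omega_of_mem _ m hi,
      M.cor_omega]
    · intro j _ hj
      exact M.transfer_omega_of_notMem _ m fun h => hj (huniq j h)
    · exact fun h => (h (Finset.mem_univ i)).elim
  rw [← this, sum_apply]

theorem PreCoShf.sumMap_apply (M : PreCoShf R) {n : ℕ} (U : Fin n → Clopens M.X)
    (a : ∀ i, M.F.obj (U i)) : M.sumMap U a =
      ∑ i, M.cor (Finset.le_sup (f := U) (Finset.mem_univ i)) (a i) := by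
  simp [PreCoShf.sumMap]

theorem PreCoShf.pMap_apply (M : PreCoShf R) {n : ℕ} (U : Fin n → Clopens M.X)
    (b : ∀ ij : Fin n × Fin n, M.F.obj (U ij.1 ⊓ U ij.2)) (i : Fin n) :
    M.pMap U b i = ∑ j, M.cor inf_le_left (b (i, j)) := by
  simp only [PreCoShf.pMap, LinearMap.sum_apply, Finset.sum_apply, LinearMap.comp_apply,
    Fintype.sum_prod_type]
  rw [Finset.sum_eq_single i]
  · exact Finset.sum_congr rfl fun j _ => Pi.single_eq_same _ _
  · intro k _ hk
    exact Finset.sum_eq_zero fun j _ => Pi.single_eq_of_ne (Ne.symm hk) _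
  · exact fun h => (h (Finset.mem_univ i)).elim

theorem PreCoShf.qMap_apply (M : PreCoShf R) {n : ℕ} (U : Fin n → Clopens M.X)
    (b : ∀ ij : Fin n × Fin n, M.F.obj (U ij.1 ⊓ U ij.2)) (j : Fin n) :
    M.qMap U b j = ∑ i, M.cor inf_le_right (b (i, j)) := by
  simp only [PreCoShf.qMap, LinearMap.sum_apply, Finset.sum_apply, LinearMap.comp_apply,
    Fintype.sum_prod_type_right]
  rw [Finset.sum_eq_single j]
  · exact Finset.sum_congr rfl fun i _ => Pi.single_eq_same _ _
  · intro k _ hk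
    exact Finset.sum_eq_zero fun i _ => Pi.single_eq_of_ne (Ne.symm hk) _
  · exact fun h => (h (Finset.mem_univ j)).elim

/-- Both composites send `b` to the sum over all pairs of the corestrictions of `b (i, j)` to the
union, by functoriality. This half of exactness needs no cosheaf condition. -/
theorem PreCoShf.sumMap_pMap_sub_qMap (M : PreCoShf R) {n : ℕ} (U : Fin n → Clopens M.X)
    (b : ∀ ij : Fin n × Fin n, M.F.obj (U ij.1 ⊓ U ij.2)) :
    M.sumMap U ((M.pMap U - M.qMap U) b) = 0 := by
  rw [LinearMap.sub_apply, map_sub, sub_eq_zero, M.sumMap_apply, M.sumMap_apply]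
  simp only [M.pMap_apply, M.qMap_apply, map_sum, M.cor_cor]
  exact Finset.sum_comm

/-- A finite family of clopen sets has a disjoint refinement with the same union. -/
theorem exists_disjoint_refinement {X : Type*} [TopologicalSpace X] {n : ℕ}
    (U : Fin n → Clopens X) : ∃ D : Fin n → Clopens X, (∀ i, D i ≤ U i) ∧
      ∀ x ∈ Finset.univ.sup U, ∃! i, x ∈ D i := by
  have mem_sup : ∀ (s : Finset (Fin n)) (x : X), x ∈ s.sup U ↔ ∃ i ∈ s, x ∈ U i := by
    intro s x
    induction s using Finset.induction_on with
    | empty => exact ⟨fun h => h.elim, fun ⟨_, h, _⟩ => (Finset.notMem_empty _ h).elim⟩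
    | insert j s hj ih =>
      rw [Finset.sup_insert, Finset.exists_mem_insert, ← ih]
      exact Iff.rfl
  -- A point is assigned to the first `U i` that contains it.
  let D : Fin n → Clopens X := fun i => U i \ (Finset.univ.filter (· < i)).sup U
  have memD : ∀ i x, x ∈ D i ↔ x ∈ U i ∧ ∀ j < i, x ∉ U j := by
    intro i x
    refine and_congr_right fun _ => ?_
    refine (not_congr (mem_sup _ x)).trans ?_
    simp
  refine ⟨D, fun i x hx => hx.1, fun x hx => ?_⟩
  obtain ⟨i, -, hi⟩ := (mem_sup _ _).mp hx
  obtain ⟨k, hk, hmin⟩ := WellFounded.has_min (wellFounded_lt (α := Fin n)) {i | x ∈ U i} ⟨i, hi⟩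
  refine ⟨k, (memD k x).mpr ⟨hk, fun j hj hx => hmin j hx hj⟩, fun j hj => ?_⟩
  obtain ⟨hj, hj'⟩ := (memD j x).mp hj
  rcases lt_trichotomy j k with h | h | h
  · exact (hmin j hj h).elim
  · exact h
  · exact (hj' k h hk).elim

/-- The precosheaf `U ↦ ⊞_{u ∈ U} M_u` is a cosheaf. -/
theorem PShf.isCosheaf_toPreCoShf (M : PShf R) : isCosheaf R M.toPreCoShf := by
  intro n U
  obtain ⟨D, hDU, hD⟩ := exists_disjoint_refinement U
  have hle : ∀ i, U i ≤ Finset.univ.sup U := fun i => Finset.le_sup (Finset.mem_univ i)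
  -- A section of the sum map: the part over `D i` is placed in `U i`.
  let φ : (M.directSum (Finset.univ.sup U)) → ∀ i, M.directSum (U i) :=
    fun a i => M.transfer _ (D i) (U i) (inf_le_right.trans (hDU i)) a
  -- The homotopy: the part of `a j` over `D i` is placed in `U i ⊓ U j`. It satisfies `q (h a) = a`
  -- and `p (h a) = φ (sumMap a)`, so a kernel element `a` equals `(p - q) (-h a)`.
  let h : (∀ i, M.directSum (U i)) → ∀ ij : Fin n × Fin n, M.directSum (U ij.1 ⊓ U ij.2) :=
    fun a ij => M.transfer (U ij.2) (D ij.1) _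
      (le_inf (inf_le_right.trans (hDU _)) inf_le_left) (a ij.2)
  refine ⟨fun a => ⟨fun ha => ?_, ?_⟩, fun a => ⟨φ a, ?_⟩⟩
  · refine ⟨-h a, ?_⟩
    refine (map_neg (M.toPreCoShf.pMap U - M.toPreCoShf.qMap U) (h a)).trans ?_
    refine (neg_sub (M.toPreCoShf.pMap U (h a)) (M.toPreCoShf.qMap U (h a))).trans ?_
    funext j
    refine (congrArg₂ (· - ·) (M.toPreCoShf.qMap_apply U (h a) j)
      (M.toPreCoShf.pMap_apply U (h a) j)).trans ?_
    have h1 : ∑ i, M.toPreCoShf.cor (U := U i ⊓ U j) inf_le_right (h a (i, j)) = a j := by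
      refine (Finset.sum_congr rfl fun i _ => M.cor_transfer _ _ _).trans ?_
      refine (M.sum_transfer le_rfl D (fun x hx => hD x (hle j hx)) (a j)).trans ?_
      exact M.toPreCoShf.cor_self _ _
    -- The sum is the projection to `D j` of the total `∑ k, a k` in the union, and that total is
    -- zero by `ha`.
    have h2 : ∑ k, M.toPreCoShf.cor (U := U j ⊓ U k) inf_le_left (h a (j, k)) = 0 := by
      refine (Finset.sum_congr rfl fun k _ => (M.cor_transfer _ _ _).trans
        (M.transfer_cor (inf_le_right.trans (hDU j)) (hle k) (a k)).symm).trans ?_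
      rw [← map_sum]
      refine (congrArg _ ((M.toPreCoShf.sumMap_apply U a).symm.trans ha)).trans ?_
      exact map_zero _
    exact (congrArg₂ (· - ·) h1 h2).trans (sub_zero _)
  · rintro ⟨b, rfl⟩
    exact M.toPreCoShf.sumMap_pMap_sub_qMap U b
  · refine (M.toPreCoShf.sumMap_apply U (φ a)).trans ?_
    refine (Finset.sum_congr rfl fun i _ => M.cor_transfer _ _ _).trans ?_
    refine (M.sum_transfer le_rfl D hD a).trans ?_
    exact M.toPreCoShf.cor_self _ _

/-! ### Two-set consequences of the cosheaf condition -/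

/-- For the empty family, the cosheaf condition makes the zero module surject onto `M(∅)`. -/
theorem PreCoShf.subsingleton_bot {M : PreCoShf R} (hM : isCosheaf R M) :
    Subsingleton (M.F.obj ⊥) := by
  refine ⟨fun a b => ?_⟩
  obtain ⟨a', rfl⟩ := (hM 0 Fin.elim0).2 a
  obtain ⟨b', rfl⟩ := (hM 0 Fin.elim0).2 b
  rw [Subsingleton.elim a' b']

theorem PreCoShf.cor_eq_zero_of_le_bot {M : PreCoShf R} (hM : isCosheaf R M) {U V : Clopens M.X}
    (h : U ≤ V) (hU : U ≤ ⊥) (a : M.F.obj U) : M.cor h a = 0 := by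
  have := subsingleton_bot hM
  rw [← M.cor_cor hU bot_le, Subsingleton.elim (M.cor hU a) 0, map_zero]

/-- The case `n = 2` of surjectivity. Inequalities replace `W = U ⊔ V`, so that no transport along
equalities of clopen sets is needed. -/
theorem PreCoShf.exists_cor_add_cor {M : PreCoShf R} (hM : isCosheaf R M) {U V W : Clopens M.X}
    (hU : U ≤ W) (hV : V ≤ W) (hW : W ≤ U ⊔ V) (a : M.F.obj W) :
    ∃ (b : M.F.obj U) (c : M.F.obj V), a = M.cor hU b + M.cor hV c := by
  have hW' : W ≤ Finset.univ.sup ![U, V] := by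
    rw [Finset.univ_fin2]; simpa using hW
  have hW'' : Finset.univ.sup ![U, V] ≤ W := by simp [Fin.forall_fin_two, hU, hV]
  obtain ⟨s, hs⟩ := (hM 2 ![U, V]).2 (M.cor hW' a)
  refine ⟨s 0, s 1, ?_⟩
  have := congrArg (M.cor hW'') hs
  rw [M.cor_cor, M.cor_self, M.sumMap_apply, map_sum, Fin.sum_univ_two, M.cor_cor, M.cor_cor] at this
  exact this.symm

/-- For disjoint `U` and `V` the map `p - q` vanishes: the off-diagonal intersections are empty and
the diagonal terms cancel. Exactness then makes the sum map injective. -/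
theorem PreCoShf.eq_zero_of_cor_add_cor {M : PreCoShf R} (hM : isCosheaf R M)
    {U V W : Clopens M.X} (hU : U ≤ W) (hV : V ≤ W) (hW : W ≤ U ⊔ V) (hd : Disjoint U V)
    {b : M.F.obj U} {c : M.F.obj V} (h : M.cor hU b + M.cor hV c = 0) : b = 0 ∧ c = 0 := by
  have hW' : W ≤ Finset.univ.sup ![U, V] := by
    rw [Finset.univ_fin2]; simpa using hW
  let s : ∀ i, M.F.obj (![U, V] i) := Fin.cons b (Fin.cons c finZeroElim)
  have hs : M.sumMap ![U, V] s = 0 := by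
    have := congrArg (M.cor hW') h
    rw [map_add, map_zero, M.cor_cor, M.cor_cor] at this
    rw [M.sumMap_apply, Fin.sum_univ_two]
    exact this
  obtain ⟨t, ht⟩ := ((hM 2 ![U, V]).1 s).mp hs
  have h0 : ∀ i j : Fin 2, i ≠ j → ![U, V] i ⊓ ![U, V] j ≤ ⊥ := by
    intro i j hij
    fin_cases i <;> fin_cases j
    · exact (hij rfl).elim
    · exact hd.le_bot
    · exact hd.symm.le_bot
    · exact (hij rfl).elim
  have hz : s = 0 := by
    rw [← ht, LinearMap.sub_apply, sub_eq_zero]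
    funext i
    rw [M.pMap_apply, M.qMap_apply]
    rw [Finset.sum_eq_single i, Finset.sum_eq_single i]
    · exact fun j _ hj => cor_eq_zero_of_le_bot hM _ (h0 _ _ hj) _
    · exact fun h => (h (Finset.mem_univ i)).elim
    · exact fun j _ hj => cor_eq_zero_of_le_bot hM _ (h0 _ _ hj.symm) _
    · exact fun h => (h (Finset.mem_univ i)).elim
  exact ⟨congrFun hz 0, congrFun hz 1⟩

/-! ### The fibres of a `sheaf' are profinite modules -/

/-- The (finite) quotient of a profinite module by an open submodule. -/
def PMod.quotient {P : Type u} [AddCommGroup P] [Module R P] [TopologicalSpace P]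
    [IsTopologicalAddGroup P] [ContinuousSMul R P] [CompactSpace P] (K : Submodule R P)
    (hK : IsOpen (K : Set P)) : PMod R :=
  haveI : CompactSpace (P ⧸ K) := Quotient.compactSpace
  haveI : DiscreteTopology (P ⧸ K) := QuotientAddGroup.discreteTopology (N := K.toAddSubgroup) hK
  { carrier := P ⧸ K }

/-- The projection to the quotient by an open submodule. -/
def PMod.mkQ {P : Type u} [AddCommGroup P] [Module R P] [TopologicalSpace P]
    [IsTopologicalAddGroup P] [ContinuousSMul R P] [CompactSpace P] (K : Submodule R P)
    (hK : IsOpen (K : Set P)) : P →L[R] PMod.quotient K hK :=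
  K.mkQL

theorem PMod.mkQ_eq_zero {P : Type u} [AddCommGroup P] [Module R P] [TopologicalSpace P]
    [IsTopologicalAddGroup P] [ContinuousSMul R P] [CompactSpace P] {K : Submodule R P}
    {hK : IsOpen (K : Set P)} {a : P} : PMod.mkQ K hK a = 0 ↔ a ∈ K :=
  Submodule.Quotient.mk_eq_zero K

instance {P : Type u} [AddCommGroup P] [Module R P] [TopologicalSpace P]
    [IsTopologicalAddGroup P] [ContinuousSMul R P] [CompactSpace P] (K : Submodule R P)
    (hK : IsOpen (K : Set P)) : DiscreteTopology (PMod.quotient K hK) :=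
  QuotientAddGroup.discreteTopology (N := K.toAddSubgroup) hK

/-- The continuity axioms of a `sheaf' speak of the fibre over `M.p m`; this and `PShf.add_val` move
the operations there from a fibre over a fixed `x`. -/
theorem PShf.smul_val (M : PShf R) {x : M.X} (r : R) (a : Fibre M.p x) :
    (r • a).1 = (r • (⟨a.1, rfl⟩ : Fibre M.p (M.p a.1))).1 := by
  obtain ⟨m, rfl⟩ := a
  rfl

theorem PShf.add_val (M : PShf R) {x : M.X} (a b : Fibre M.p x) :
    (a + b).1 = ((⟨a.1, a.2.trans b.2.symm⟩ : Fibre M.p (M.p b.1)) + ⟨b.1, rfl⟩).1 := by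
  obtain ⟨m, rfl⟩ := b
  rfl

instance (M : PShf R) (x : M.X) : ContinuousSMul R (Fibre M.p x) :=
  ⟨(((M.continuous_smul.comp (continuous_fst.prodMk
    (continuous_subtype_val.comp continuous_snd))).congr
      fun z => (M.smul_val z.1 z.2).symm).subtype_mk fun z => (z.1 • z.2).2)⟩

instance (M : PShf R) (x : M.X) : IsTopologicalAddGroup (Fibre M.p x) where
  continuous_add := by
    have h : Continuous fun z : Fibre M.p x × Fibre M.p x =>
        (⟨(z.1.1, z.2.1), z.1.2.trans z.2.2.symm⟩ :
          {z : M.total × M.total // M.p z.1 = M.p z.2}) :=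
      ((continuous_subtype_val.comp continuous_fst).prodMk
        (continuous_subtype_val.comp continuous_snd)).subtype_mk _
    exact ((M.continuous_add.comp h).congr
      fun z => (M.add_val z.1 z.2).symm).subtype_mk fun z => (z.1 + z.2).2
  continuous_neg := by
    refine (continuous_const_smul (-1 : R)).congr fun a => ?_
    rw [neg_one_smul]

instance (M : PShf R) (x : M.X) : CompactSpace (Fibre M.p x) :=
  isCompact_iff_compactSpace.mp
    (isClosed_singleton.preimage M.p.continuous : IsClosed (M.p ⁻¹' {x})).isCompact

instance (M : PShf R) (U : Clopens M.X) : CompactSpace (M.Over U) :=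
  isCompact_iff_compactSpace.mp (U.isClosed.preimage M.p.continuous).isCompact

instance (M : PShf R) : CompactSpace {z : M.total × M.total // M.p z.1 = M.p z.2} :=
  isCompact_iff_compactSpace.mp (isClosed_eq (M.p.continuous.comp continuous_fst)
    (M.p.continuous.comp continuous_snd)).isCompact

/-! ### Fibres of a `sheaf' and stalks of its cosheaf -/

/-- A point outside the image of a closed set has a clopen neighbourhood outside the image. -/
theorem exists_clopens_disjoint_image {X : Profinite.{u}} {Z : Type*} [TopologicalSpace Z]
    [CompactSpace Z] {π : Z → X} (hπ : Continuous π) {B : Set Z} (hB : IsClosed B) {x : X}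
    (hx : ∀ z ∈ B, π z ≠ x) : ∃ U : Clopens X, x ∈ U ∧ ∀ z ∈ B, π z ∉ U := by
  have hcl : IsClosed (π '' B) := (hB.isCompact.image hπ).isClosed
  obtain ⟨V, hV, hxV, hVB⟩ := compact_exists_isClopen_in_isOpen hcl.isOpen_compl
    (x := x) (by rintro ⟨z, hz, h⟩; exact hx z hz h)
  exact ⟨⟨V, hV⟩, hxV, fun z hz h => hVB h ⟨z, hz, rfl⟩⟩

/-- A continuous homomorphism from a fibre to a finite module extends to a neighbourhood. -/
theorem PShf.exists_homOver_extending [CompactSpace R] (M : PShf R) (x : M.X) (P : PMod R)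
    [DiscreteTopology P] (f : Fibre M.p x →L[R] P) :
    ∃ (U : Clopens M.X) (hx : x ∈ U) (β : M.HomOver U P),
      ∀ a : Fibre M.p x, β.toMap (M.toOver hx a) = f a := by
  have : Finite P := finite_of_compact_of_discrete
  -- A continuous map from a closed subspace of a profinite space to a finite discrete set extends
  -- to the whole space; the one-point sets make the rest of the lifting square trivial. So far `k`
  -- is linear only on the fibre over `x`.
  obtain ⟨k, hk, -, hkf⟩ := Profinite.exists_lift_of_finite_of_injective_of_surjective
    (Subtype.val : Fibre M.p x → M.total) continuous_subtype_val Subtype.val_injective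
    (fun _ : P => PUnit.unit.{1}) (fun _ => ⟨0, rfl⟩) f f.continuous (fun _ : M.total => PUnit.unit.{1})
    continuous_const rfl
  have hkf' : ∀ a : Fibre M.p x, k a.1 = f a := congrFun hkf
  -- The pairs where `k` fails to be additive form a closed set, as `P` is discrete. None lies over
  -- `x`, so by compactness none lies over some clopen neighbourhood.
  obtain ⟨U, hxU, hU⟩ := exists_clopens_disjoint_image
    (π := fun z : {z : M.total × M.total // M.p z.1 = M.p z.2} => M.p z.1.2)
    (M.p.continuous.comp (continuous_snd.comp continuous_subtype_val))
    (B := (fun z => k (((⟨z.1.1, z.2⟩ : Fibre M.p (M.p z.1.2)) + ⟨z.1.2, rfl⟩).1) -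
      (k z.1.1 + k z.1.2)) ⁻¹' {0}ᶜ)
    ((isClosed_discrete _).preimage ((hk.comp M.continuous_add).sub
      ((hk.comp (continuous_fst.comp continuous_subtype_val)).add
        (hk.comp (continuous_snd.comp continuous_subtype_val))))) (x := x) (by
      rintro ⟨⟨m, m'⟩, h⟩ hz rfl
      refine hz (sub_eq_zero.mpr ?_)
      have := map_add f ⟨m, h⟩ ⟨m', rfl⟩
      rwa [← hkf', ← hkf', ← hkf'] at this)
  -- The same argument for scalars; compactness of `R × M.total` uses that of `R`.
  obtain ⟨V, hxV, hV⟩ := exists_clopens_disjoint_image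
    (π := fun z : R × M.total => M.p z.2) (M.p.continuous.comp continuous_snd)
    (B := (fun z => k ((z.1 • (⟨z.2, rfl⟩ : Fibre M.p (M.p z.2))).1) - z.1 • k z.2) ⁻¹' {0}ᶜ)
    ((isClosed_discrete _).preimage ((hk.comp M.continuous_smul).sub
      (continuous_fst.smul (hk.comp continuous_snd)))) (x := x) (by
      rintro ⟨r, m⟩ hz rfl
      refine hz (sub_eq_zero.mpr ?_)
      have := map_smul f r ⟨m, rfl⟩
      rwa [← hkf', ← hkf'] at this)
  refine ⟨U ⊓ V, ⟨hxU, hxV⟩, ⟨⟨fun m => k m.1, hk.comp continuous_subtype_val⟩,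
    fun y hy a b => ?_, fun y hy r a => ?_⟩, hkf'⟩
  · by_contra h
    refine hU ⟨(a.1, b.1), a.2.trans b.2.symm⟩ (fun h' => h ?_) (by rw [b.2]; exact hy.1)
    exact (congrArg k (M.add_val a b)).trans (sub_eq_zero.mp h')
  · by_contra h
    refine hV (r, a.1) (fun h' => h ?_) (by rw [a.2]; exact hy.2)
    exact (congrArg k (M.smul_val r a)).trans (sub_eq_zero.mp h')

/-- The map from a fibre to the profinite direct sum. -/
noncomputable def PShf.fibreOmega (M : PShf R) {U : Clopens M.X} {x : M.X} (hx : x ∈ U) :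
    Fibre M.p x →L[R] M.directSum U where
  toFun a := (M.omega U).toMap (M.toOver hx a)
  map_add' := (M.omega U).map_add x hx
  map_smul' := (M.omega U).map_smul x hx
  cont := (M.omega U).toMap.continuous.comp (continuous_subtype_val.subtype_mk _)

theorem PShf.fibreOmega_zero (M : PShf R) {U : Clopens M.X} {x : M.X} (hx : x ∈ U) :
    M.fibreOmega hx 0 = 0 :=
  map_zero _

/-- The profinite direct sums over neighbourhoods of `x` separate the points of the fibre. -/
theorem PShf.eq_zero_of_fibreOmega [CompactSpace R] (M : PShf R) {x : M.X} {a : Fibre M.p x}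
    (h : ∀ (U : Clopens M.X) (hx : x ∈ U), M.fibreOmega hx a = 0) : a = 0 := by
  by_contra ha
  obtain ⟨K, hK, -, -, haK⟩ := exists_isOpen_submodule_of_notMem (R := R)
    (B := (⊥ : Submodule R (Fibre M.p x))) (by simp) (s := a) ha
  -- The extended quotient map factors through the direct sum over `U`, where `a` becomes zero; this
  -- forces `a ∈ K`.
  obtain ⟨U, hx, β, hβ⟩ := M.exists_homOver_extending x _ (PMod.mkQ K hK)
  refine haK (PMod.mkQ_eq_zero.mp ((hβ a).symm.trans ?_))
  refine (M.lift_omega β _).symm.trans ?_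
  exact (congrArg (M.lift β) (h U hx)).trans (map_zero _)

/-- A map from the profinite direct sum takes values in an open submodule if it does so on the
summands. -/
theorem PShf.mem_of_omega_mem (M : PShf R) {U : Clopens M.X} {P : PMod R} {K : Submodule R P}
    (hK : IsOpen (K : Set P)) (φ : M.directSum U →L[R] P)
    (h : ∀ m, φ ((M.omega U).toMap m) ∈ K) (d : M.directSum U) : φ d ∈ K := by
  have : (PMod.mkQ K hK).comp φ = 0 :=
    M.directSum_ext fun m => PMod.mkQ_eq_zero.mpr (h m)
  exact PMod.mkQ_eq_zero.mp (congrArg (fun ψ => ψ d) this)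

/-- If the component were outside the closed image of the fibre, an open submodule `K` would contain
the image and miss the component. By compactness all summands over a small neighbourhood `V` of `x`
map into `K`. The component comes by corestriction from `V ⊓ U`, so it lies in `K` after all. -/
theorem PShf.stalk_mem_range_fibreOmega [CompactSpace R] (M : PShf R) {x : M.X}
    (s : M.toPreCoShf.stalk x) {U : Clopens M.X} (hx : x ∈ U) :
    s.1 ⟨U, hx⟩ ∈ LinearMap.range (M.fibreOmega hx).toLinearMap := by
  by_contra hs
  obtain ⟨K, hK, -, hBK, hsK⟩ := exists_isOpen_submodule_of_notMem (R := R)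
    (P := M.directSum U) (isCompact_range (M.fibreOmega hx).continuous).isClosed hs
  obtain ⟨V, hxV, hV⟩ := exists_clopens_disjoint_image (π := fun m : M.Over U => M.p m.1)
    (M.p.continuous.comp continuous_subtype_val)
    (hK.isClosed_compl.preimage (M.omega U).toMap.continuous) (x := x)
    (fun m hm hmx => hm (hBK ⟨⟨m.1, hmx⟩, rfl⟩))
  refine hsK ?_
  rw [← s.2 ⟨V ⊓ U, ⟨hxV, hx⟩⟩ ⟨U, hx⟩ inf_le_right]
  refine M.mem_of_omega_mem hK (M.cor inf_le_right) (fun m => ?_) _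
  rw [M.cor_omega]
  by_contra hm
  exact hV _ hm m.2.1

/-- The stalks of the cosheaf of a `sheaf' are its fibres: surjectivity. -/
theorem PShf.exists_fibreOmega_eq [CompactSpace R] (M : PShf R) {x : M.X}
    (s : M.toPreCoShf.stalk x) :
    ∃ a : Fibre M.p x, ∀ (U : Clopens M.X) (hx : x ∈ U), M.fibreOmega hx a = s.1 ⟨U, hx⟩ := by
  -- The candidates that are correct at `U`: nonempty closed sets, directed downwards because being
  -- correct at `U` implies it at every larger set. Compactness of the fibre gives a common point.
  let A : {U : Clopens M.X // x ∈ U} → Set (Fibre M.p x) :=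
    fun U => {a | M.fibreOmega U.2 a = s.1 U}
  have hA : ∀ U, IsClosed (A U) := fun U =>
    isClosed_eq (M.fibreOmega U.2).continuous continuous_const
  have : Nonempty {U : Clopens M.X // x ∈ U} := ⟨⟨⊤, trivial⟩⟩
  have key : ∀ U V : {U : Clopens M.X // x ∈ U}, U.1 ≤ V.1 → A U ⊆ A V := by
    intro U V h a ha
    refine Eq.trans ?_ (s.2 U V h)
    refine Eq.trans ?_ (congrArg (M.cor h) ha)
    exact (M.cor_omega h (M.toOver U.2 a)).symm
  obtain ⟨a, ha⟩ := IsCompact.nonempty_iInter_of_directed_nonempty_isCompact_isClosed A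
    (fun U V => ⟨⟨U.1 ⊓ V.1, ⟨U.2, V.2⟩⟩, key _ _ inf_le_left, key _ _ inf_le_right⟩)
    (fun U => M.stalk_mem_range_fibreOmega s U.2) (fun U => (hA U).isCompact) hA
  exact ⟨a, fun U hx => Set.mem_iInter.mp ha ⟨U, hx⟩⟩

/-! ### Isomorphisms of `sheaves' and of precosheaves -/

/-- Used for additivity of an inverse morphism. The equation `φ.base x = y` is a hypothesis on free
variables so that it can be substituted, which avoids transport between fibres. -/
theorem PShf.Hom.eq_add_of_map_eq {N M : PShf R} (φ : PShf.Hom N M)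
    (hφ : Function.Injective φ.map) {x : N.X} {y : M.X} (h : φ.base x = y) {a b : Fibre M.p y}
    {a' b' c' : Fibre N.p x} (ha : φ.map a'.1 = a.1) (hb : φ.map b'.1 = b.1)
    (hc : φ.map c'.1 = (a + b).1) : c' = a' + b' := by
  subst h
  obtain rfl : Fibre.map φ.comm x a' = a := Subtype.ext ha
  obtain rfl : Fibre.map φ.comm x b' = b := Subtype.ext hb
  rw [← φ.map_add] at hc
  exact Subtype.ext (hφ hc)

theorem PShf.Hom.eq_smul_of_map_eq {N M : PShf R} (φ : PShf.Hom N M)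
    (hφ : Function.Injective φ.map) {x : N.X} {y : M.X} (h : φ.base x = y) {r : R}
    {a : Fibre M.p y} {a' c' : Fibre N.p x} (ha : φ.map a'.1 = a.1)
    (hc : φ.map c'.1 = (r • a).1) : c' = r • a' := by
  subst h
  obtain rfl : Fibre.map φ.comm x a' = a := Subtype.ext ha
  rw [← φ.map_smul] at hc
  exact Subtype.ext (hφ hc)

/-- A morphism of `sheaves' that is bijective on base spaces and on total spaces is an
isomorphism. -/
theorem PShf.isIso_of_bijective {N M : PShf R} (φ : N ⟶ M)
    (hb : Function.Bijective (PShf.Hom.base φ)) (ht : Function.Bijective (PShf.Hom.map φ)) :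
    IsIso φ := by
  let Φ : PShf.Hom N M := φ
  let eb : N.X ≃ₜ M.X :=
    Continuous.homeoOfEquivCompactToT2 (f := Equiv.ofBijective _ hb) Φ.base.continuous
  let et : N.total ≃ₜ M.total :=
    Continuous.homeoOfEquivCompactToT2 (f := Equiv.ofBijective _ ht) Φ.map.continuous
  have heb : ∀ y, Φ.base (eb.symm y) = y := eb.apply_symm_apply
  have het : ∀ m, Φ.map (et.symm m) = m := et.apply_symm_apply
  let Ψ : PShf.Hom M N :=
    { base := eb.symm
      map := et.symm
      comm := fun m => hb.1 (((Φ.comm _).symm.trans (congrArg M.p (het m))).trans (heb _).symm)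
      map_add := fun y a b =>
        Φ.eq_add_of_map_eq ht.1 (heb y) (het a.1) (het b.1) (het (a + b).1)
      map_smul := fun y r a => Φ.eq_smul_of_map_eq ht.1 (heb y) (het a.1) (het (r • a).1) }
  refine ⟨Ψ, PShf.Hom.ext' ?_ ?_, PShf.Hom.ext' ?_ ?_⟩
  · exact ContinuousMap.ext eb.symm_apply_apply
  · exact ContinuousMap.ext et.symm_apply_apply
  · exact ContinuousMap.ext heb
  · exact ContinuousMap.ext het

/-- A morphism of profinite modules as a continuous linear map. -/
abbrev PMod.toCLM {P Q : PMod R} (φ : P ⟶ Q) : P →L[R] Q := φ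

/-- A natural transformation of functors on clopen sets is a morphism of precosheaves. -/
def PreCoShf.Hom.ofNatTrans {X : Profinite.{u}} {F G : Clopens X ⥤ PMod R} (α : F ⟶ G) :
    PreCoShf.Hom (PreCoShf.mk X F) (PreCoShf.mk X G) where
  base := ContinuousMap.id X
  app U V := (PMod.toCLM (α.app U)).comp (PMod.toCLM (F.map (homOfLE inf_le_left)))
  naturality {U U' V V'} hU hV a := by
    have h1 := (PreCoShf.mk X F).cor_cor (inf_le_inf (preim_mono (ContinuousMap.id X) hU) hV)
      (inf_le_left : preim (ContinuousMap.id X) U' ⊓ V' ≤ U') a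
    have h2 := (PreCoShf.mk X F).cor_cor
      (inf_le_left : preim (ContinuousMap.id X) U ⊓ V ≤ U) hU a
    have h3 := congrArg (fun ψ : F.obj U ⟶ G.obj U' =>
      PMod.toCLM ψ ((PreCoShf.mk X F).cor (inf_le_left : preim (ContinuousMap.id X) U ⊓ V ≤ U) a))
      (α.naturality (homOfLE hU))
    exact (congrArg (PMod.toCLM (α.app U')) (h1.trans h2.symm)).trans h3

/-- A natural isomorphism of functors on clopen sets is an isomorphism of precosheaves. -/
def PreCoShf.isoOfNatIso {X : Profinite.{u}} {F G : Clopens X ⥤ PMod R} (α : F ≅ G) :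
    PreCoShf.mk X F ≅ PreCoShf.mk X G := by
  have key : ∀ {F G : Clopens X ⥤ PMod R} (α : F ⟶ G) (β : G ⟶ F), α ≫ β = 𝟙 F →
      (PreCoShf.Hom.ofNatTrans α).comp (PreCoShf.Hom.ofNatTrans β) =
        PreCoShf.Hom.id (PreCoShf.mk X F) := by
    intro F G α β h
    refine PreCoShf.Hom.ext' rfl fun U V hle a => ?_
    have hU : ∀ b : F.obj U, (PMod.toCLM (β.app U))
        ((PMod.toCLM (α.app U)) b) = b := fun b =>
      congrArg (fun ψ : F.obj U ⟶ F.obj U => PMod.toCLM ψ b) (congrArg (fun γ => γ.app U) h)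
    let N := PreCoShf.mk X F
    let L := PreCoShf.mk X G
    refine ((N.cor_cor _ _ _).trans (hU _).symm).trans ?_
    refine congrArg (PMod.toCLM (β.app U)) ?_
    refine Eq.trans ?_ (L.cor_cor _ _ _).symm
    refine (L.cor_self le_rfl _).symm.trans (congrArg (L.cor _) ?_)
    exact congrArg (PMod.toCLM (α.app U))
      ((N.cor_cor _ _ _).symm : N.cor _ a = N.cor _ (N.cor _ a))
  exact
    { hom := PreCoShf.Hom.ofNatTrans α.hom
      inv := PreCoShf.Hom.ofNatTrans α.inv
      hom_inv_id := key _ _ α.hom_inv_id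
      inv_hom_id := key _ _ α.inv_hom_id }

/-- A bijective continuous linear map of profinite modules is an isomorphism. -/
theorem PMod.isIso_of_bijective {P Q : PMod R} (φ : P ⟶ Q)
    (h : Function.Bijective (PMod.toCLM φ)) : IsIso φ := by
  let Φ : P →L[R] Q := φ
  let e : P ≃ₗ[R] Q := LinearEquiv.ofBijective Φ.toLinearMap h
  let et : P ≃ₜ Q := Continuous.homeoOfEquivCompactToT2 (f := e.toEquiv) Φ.continuous
  let Ψ : Q →L[R] P := ⟨e.symm.toLinearMap, et.symm.continuous⟩
  exact ⟨Ψ, ContinuousLinearMap.ext e.symm_apply_apply, ContinuousLinearMap.ext e.apply_symm_apply⟩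

/-! ### A `sheaf' is the `sheaf' of stalks of its cosheaf -/

theorem PreCoShf.Total.ext_of_val {M : PreCoShf R} {m m' : M.Total} (h : m.pt = m'.pt)
    (h' : ∀ U (h₁ : m.pt ∈ U) (h₂ : m'.pt ∈ U), m.val.1 ⟨U, h₁⟩ = m'.val.1 ⟨U, h₂⟩) : m = m' := by
  obtain ⟨x, s⟩ := m
  obtain ⟨y, t⟩ := m'
  obtain rfl : x = y := h
  congr 1
  exact Subtype.ext (funext fun U => h' U.1 U.2 U.2)

/-- A point of a `sheaf', as a point of the space of stalks of the cosheaf of the `sheaf'. -/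
noncomputable def PShf.germ (M : PShf R) (m : M.total) : M.toPreCoShf.Total where
  pt := M.p m
  val := ⟨fun U => (M.omega U.1).toMap ⟨m, U.2⟩, fun U V h => M.cor_omega (V := V.1) h ⟨m, U.2⟩⟩

theorem PShf.continuous_germ (M : PShf R) : Continuous M.germ := by
  refine continuous_generateFrom_iff.mpr ?_
  rintro _ ⟨U, W, hW, rfl⟩
  have hU : IsOpen {m : M.total | M.p m ∈ U} := U.isOpen.preimage M.p.continuous
  convert hU.isOpenEmbedding_subtypeVal.isOpenMap _
    (hW.preimage (M.omega U).toMap.continuous) using 1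
  ext m
  exact ⟨fun ⟨h, h'⟩ => ⟨⟨m, h⟩, h', rfl⟩, by rintro ⟨⟨m, h⟩, h', rfl⟩; exact ⟨h, h'⟩⟩

theorem PShf.fibreEquiv_germ (M : PShf R) {x : M.X} (a : Fibre M.p x) (U : Clopens M.X)
    (hx : x ∈ U) : (M.toPreCoShf.fibreEquiv x ⟨M.germ a.1, a.2⟩).1 ⟨U, hx⟩ =
      M.fibreOmega hx a := by
  obtain ⟨m, rfl⟩ := a
  rfl

/-- The morphism from a `sheaf' to the `sheaf' of stalks of its cosheaf. -/
noncomputable def PShf.toStalks (M : PShf R) : PShf.Hom M M.toPreCoShf.toPShf where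
  base := ContinuousMap.id M.X
  map := ⟨M.germ, M.continuous_germ⟩
  comm _ := rfl
  map_add x a b := by
    refine (M.toPreCoShf.fibreEquiv x).injective ?_
    refine Eq.trans ?_ (M.toPreCoShf.fibreEquiv_add x _ _).symm
    refine Subtype.ext (funext fun U => ?_)
    refine (M.fibreEquiv_germ (a + b) U.1 U.2).trans ((map_add (M.fibreOmega U.2) a b).trans ?_)
    exact congrArg₂ (· + ·) (M.fibreEquiv_germ a U.1 U.2).symm (M.fibreEquiv_germ b U.1 U.2).symm
  map_smul x r a := by
    refine (M.toPreCoShf.fibreEquiv x).injective ?_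
    refine Eq.trans ?_ (M.toPreCoShf.fibreEquiv_smul x _ _).symm
    refine Subtype.ext (funext fun U => ?_)
    refine (M.fibreEquiv_germ (r • a) U.1 U.2).trans ((map_smul (M.fibreOmega U.2) r a).trans ?_)
    exact congrArg (r • ·) (M.fibreEquiv_germ a U.1 U.2).symm

theorem PShf.germ_bijective [CompactSpace R] (M : PShf R) : Function.Bijective M.germ := by
  constructor
  · intro m m' h
    have hp : M.p m = M.p m' := congrArg PreCoShf.Total.pt h
    let a : Fibre M.p (M.p m') := ⟨m, hp⟩
    let b : Fibre M.p (M.p m') := ⟨m', rfl⟩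
    -- Equal germs lie over the same base point, so injectivity reduces to a trivial kernel on one
    -- fibre.
    have hab : a - b = 0 := M.eq_zero_of_fibreOmega fun U hx => by
      rw [map_sub, sub_eq_zero]
      have hev := congrArg (M.toPreCoShf.ev U) h
      rw [PreCoShf.ev_of_mem (m := M.germ m) _ (show M.p m ∈ U from hp ▸ hx),
        PreCoShf.ev_of_mem (m := M.germ m') _ hx] at hev
      exact hev
    exact congrArg Subtype.val (sub_eq_zero.mp hab)
  · rintro ⟨x, s⟩
    obtain ⟨⟨m, rfl⟩, ha⟩ := M.exists_fibreOmega_eq s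
    exact ⟨m, PreCoShf.Total.ext_of_val rfl fun U hU _ => ha U hU⟩

theorem PShf.isIso_toStalks [CompactSpace R] (M : PShf R) :
    IsIso (C := PShf R) (X := M) (Y := M.toPreCoShf.toPShf) M.toStalks :=
  PShf.isIso_of_bijective _ Function.bijective_id M.germ_bijective

variable (R) in
/-- The functor `CoShf` with values in cosheaves. -/
noncomputable def toCoShf : PShf R ⥤ CoShf R :=
  (isCosheaf R).lift (coShf R) PShf.isCosheaf_toPreCoShf

variable (R) in
/-- `CoÉtale` after `CoShf` is the identity. -/
noncomputable def stalksIso [CompactSpace R] : 𝟭 (PShf R) ≅ toCoShf R ⋙ coEtale R :=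
  NatIso.ofComponents
    (fun M => @asIso (PShf R) _ M M.toPreCoShf.toPShf M.toStalks M.isIso_toStalks) (by
    intro N M φ
    let Φ : PShf.Hom N M := φ
    refine PShf.Hom.ext' rfl (ContinuousMap.ext fun m => ?_)
    refine PreCoShf.Total.ext_of_val (M := M.toPreCoShf) (Φ.comm m) fun U h₁ h₂ => ?_
    exact (PShf.sumHom_omega Φ (V := preim Φ.base U ⊓ ⊤) (U := U) inf_le_left
      ⟨m, h₂, trivial⟩).symm)

/-! ### A cosheaf is the cosheaf of its stalks -/

/-- A property of clopen sets that holds locally, passes to smaller sets and to disjoint unions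
holds globally. -/
theorem clopens_induction {X : Profinite.{u}} (Q : Clopens X → Prop) (hbot : Q ⊥)
    (hmono : ∀ V W, V ≤ W → Q W → Q V)
    (hsup : ∀ V W, Disjoint V W → Q V → Q W → Q (V ⊔ W)) (U : Clopens X)
    (hloc : ∀ x ∈ U, ∃ V, x ∈ V ∧ Q V) : Q U := by
  obtain ⟨V, hUV, hV⟩ : ∃ V : Clopens X, (U : Set X) ⊆ V ∧ Q V := by
    refine U.isClosed.isCompact.induction_on (p := fun s => ∃ V : Clopens X, s ⊆ V ∧ Q V)
      ⟨⊥, Set.empty_subset _, hbot⟩ (fun s t hst ⟨V, hV, hQ⟩ => ⟨V, hst.trans hV, hQ⟩) ?_ ?_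
    · rintro s t ⟨V, hV, hQV⟩ ⟨W, hW, hQW⟩
      -- Only disjoint unions are available, so `W` is first cut down to `W \ V`.
      refine ⟨V ⊔ W \ V, ?_, hsup _ _ disjoint_sdiff_self_right hQV
        (hmono _ _ sdiff_le hQW)⟩
      rw [sup_sdiff_self_right]
      exact Set.union_subset_union hV hW
    · intro x hx
      obtain ⟨V, hxV, hQ⟩ := hloc x hx
      exact ⟨V, mem_nhdsWithin_of_mem_nhds (V.isOpen.mem_nhds hxV), V, subset_rfl, hQ⟩
  exact hmono U V hUV hV

/-- A family of nonempty closed subsets of the modules `M(V)`, for `x ∈ V ≤ U`, that is stable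
under corestriction contains the components of an element of the stalk at `x`. -/
theorem PreCoShf.exists_stalk_mem (M : PreCoShf R) {x : M.X} {U : Clopens M.X} (hx : x ∈ U)
    (S : ∀ V, Set (M.F.obj V)) (hS : ∀ V, IsClosed (S V))
    (hcor : ∀ V W (h : V ≤ W), W ≤ U → ∀ a ∈ S V, M.cor h a ∈ S W)
    (hne : ∀ V, x ∈ V → V ≤ U → (S V).Nonempty) :
    ∃ s : M.stalk x, ∀ V (hV : x ∈ V), V ≤ U → s.1 ⟨V, hV⟩ ∈ S V := by
  classical
  let I := {V : Clopens M.X // x ∈ V ∧ V ≤ U}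
  -- The families that satisfy the membership and compatibility conditions only at indices above
  -- `V`. These are closed in a compact product and shrink with `V`; a point in all of them is the
  -- required stalk element.
  let C : I → Set (∀ V : {V : Clopens M.X // x ∈ V}, M.F.obj V.1) := fun V =>
    (⋂ (W : {V : Clopens M.X // x ∈ V}) (_ : V.1 ≤ W.1) (_ : W.1 ≤ U), {t | t W ∈ S W.1}) ∩
    ⋂ (W : {V : Clopens M.X // x ∈ V}) (W' : {V : Clopens M.X // x ∈ V}) (h : W.1 ≤ W'.1)
      (_ : V.1 ≤ W.1), {t | M.cor h (t W) = t W'}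
  have memC : ∀ V t, t ∈ C V ↔ (∀ W : {V : Clopens M.X // x ∈ V}, V.1 ≤ W.1 → W.1 ≤ U →
      t W ∈ S W.1) ∧ ∀ (W W' : {V : Clopens M.X // x ∈ V}) (h : W.1 ≤ W'.1), V.1 ≤ W.1 →
      M.cor h (t W) = t W' := by
    intro V t
    simp only [C, Set.mem_inter_iff, Set.mem_iInter, Set.mem_ofPred_eq]
  have hC : ∀ V, IsClosed (C V) := fun V =>
    (isClosed_iInter fun W => isClosed_iInter fun _ => isClosed_iInter fun _ =>
      (hS W.1).preimage (continuous_apply W)).inter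
    (isClosed_iInter fun W => isClosed_iInter fun W' => isClosed_iInter fun h =>
      isClosed_iInter fun _ =>
      isClosed_eq ((M.cor h).continuous.comp (continuous_apply W)) (continuous_apply W'))
  have anti : ∀ V W : I, V.1 ≤ W.1 → C V ⊆ C W := fun V W h t ht =>
    (memC W t).mpr ⟨fun Z hZ => ((memC V t).mp ht).1 Z (h.trans hZ),
      fun Z Z' hZ hW => ((memC V t).mp ht).2 Z Z' hZ (h.trans hW)⟩
  have hneC : ∀ V, (C V).Nonempty := by
    rintro ⟨V, hxV, hVU⟩
    obtain ⟨a, ha⟩ := hne V hxV hVU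
    -- The value `0` at indices not above `V` is harmless, since `C V` imposes nothing there.
    refine ⟨fun W => if h : V ≤ W.1 then M.cor h a else 0, (memC _ _).mpr
      ⟨fun W hW hWU => ?_, fun W W' h hW => ?_⟩⟩
    · rw [dif_pos (show V ≤ W.1 from hW)]
      exact hcor V W.1 hW hWU a ha
    · rw [dif_pos (show V ≤ W.1 from hW), dif_pos (show V ≤ W'.1 from hW.trans h), M.cor_cor]
  have : Nonempty I := ⟨⟨U, hx, le_rfl⟩⟩
  obtain ⟨t, ht⟩ := IsCompact.nonempty_iInter_of_directed_nonempty_isCompact_isClosed C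
    (fun V W => ⟨⟨V.1 ⊓ W.1, ⟨V.2.1, W.2.1⟩, inf_le_left.trans V.2.2⟩,
      anti _ _ inf_le_left, anti _ _ inf_le_right⟩) hneC (fun V => (hC V).isCompact) hC
  have ht' := fun V => (memC V t).mp (Set.mem_iInter.mp ht V)
  refine ⟨⟨t, fun W W' h => ?_⟩, fun V hV hVU => ?_⟩
  -- `W` need not lie in `U`, so compatibility is read off from the index `W ⊓ U`.
  · exact (ht' ⟨W.1 ⊓ U, ⟨W.2, hx⟩, inf_le_right⟩).2 W W' h inf_le_left
  · exact (ht' ⟨V, hV, hVU⟩).1 ⟨V, hV⟩ le_rfl hVU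

/-- The evaluation `(m, x) ↦ cor_x^U(m)`, as a `sheaf' morphism. -/
noncomputable def PreCoShf.evHom (M : PreCoShf R) (U : Clopens M.X) :
    M.toPShf.HomOver U (M.F.obj U) where
  toMap := ⟨fun m => M.ev U m.1, (M.continuous_ev U).comp continuous_subtype_val⟩
  map_add x _ a b := M.ev_add U x a b
  map_smul x _ r a := M.ev_smul U x r a

/-- The map `⊞_{u ∈ U} M_u → M(U)` given by evaluation. -/
noncomputable def PreCoShf.sumEv (M : PreCoShf R) (U : Clopens M.X) :
    M.toPShf.directSum U →L[R] M.F.obj U :=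
  M.toPShf.lift (M.evHom U)

theorem PreCoShf.sumEv_omega (M : PreCoShf R) (U : Clopens M.X) (m : M.toPShf.Over U) :
    M.sumEv U ((M.toPShf.omega U).toMap m) = M.ev U m.1 :=
  M.toPShf.lift_omega (M.evHom U) m

theorem PreCoShf.cor_ev (M : PreCoShf R) {U V : Clopens M.X} (h : U ≤ V) {m : M.Total}
    (hm : m.pt ∈ U) : M.cor h (M.ev U m) = M.ev V m := by
  rw [M.ev_of_mem hm, M.ev_of_mem (h hm)]
  exact m.val.2 ⟨U, hm⟩ ⟨V, h hm⟩ h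

theorem PreCoShf.sumEv_cor (M : PreCoShf R) {U V : Clopens M.X} (h : U ≤ V)
    (a : M.toPShf.directSum U) : M.sumEv V (M.toPShf.cor h a) = M.cor h (M.sumEv U a) := by
  have : (M.sumEv V).comp (M.toPShf.cor h) = (M.cor h).comp (M.sumEv U) := by
    refine M.toPShf.directSum_ext fun m => ?_
    refine (congrArg (M.sumEv V) (M.toPShf.cor_omega h m)).trans ((M.sumEv_omega V _).trans ?_)
    exact (M.cor_ev h m.2).symm.trans (congrArg (M.cor h) (M.sumEv_omega U m).symm)
  exact congrArg (fun φ => φ a) this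

/-- The neighbourhoods of `x` inside `U` are cofinal: the component at `V` is the corestriction of
the one at `V ⊓ U`. -/
theorem PreCoShf.eq_zero_of_ev (M : PreCoShf R) {x : M.X} {U : Clopens M.X} (hx : x ∈ U)
    {m : Fibre (PreCoShf.Total.pt (M := M)) x}
    (h : ∀ V, x ∈ V → V ≤ U → M.ev V m.1 = 0) : m = 0 := by
  refine (M.fibreEquiv x).injective (Subtype.ext (funext fun V => ?_))
  have h0 : M.fibreEquiv x 0 = 0 := (M.fibreEquiv x).apply_symm_apply _
  rw [h0, ← M.ev_fibre V.2]
  have hVU : x ∈ V.1 ⊓ U := ⟨V.2, hx⟩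
  have := M.cor_ev (inf_le_left : V.1 ⊓ U ≤ V.1) (m := m.1) (m.2.symm ▸ hVU)
  exact this.symm.trans ((congrArg _ (h _ hVU inf_le_right)).trans (map_zero _))

/-- The image contains the components at `U` of all stalk elements over points of `U`. An open
submodule `K` containing the image therefore contains everything that comes from small
neighbourhoods, and by additivity of a cosheaf everything in `M(U)`. -/
theorem PreCoShf.sumEv_surjective [CompactSpace R] {M : PreCoShf R} (hM : isCosheaf R M)
    (U : Clopens M.X) : Function.Surjective (M.sumEv U) := by
  by_contra hsurj
  obtain ⟨s, hs⟩ := not_forall.mp hsurj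
  obtain ⟨K, hK, -, hBK, hsK⟩ := exists_isOpen_submodule_of_notMem (R := R) (P := M.F.obj U)
    (B := LinearMap.range (M.sumEv U).toLinearMap)
    (isCompact_range (M.sumEv U).continuous).isClosed hs
  refine hsK ?_
  have key := clopens_induction
    (fun V => ∀ a : M.F.obj (V ⊓ U), M.cor inf_le_right a ∈ K) ?_ ?_ ?_ U ?_
  · have := key (M.cor (le_inf le_rfl le_rfl) s)
    rwa [M.cor_cor, M.cor_self] at this
  · intro a
    rw [cor_eq_zero_of_le_bot hM _ inf_le_left]
    exact zero_mem K
  · intro V W h hW a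
    rw [← M.cor_cor (inf_le_inf_right U h) inf_le_right]
    exact hW _
  · intro V W _ hV hW a
    obtain ⟨b, c, rfl⟩ := exists_cor_add_cor hM (inf_le_inf_right U (le_sup_left : V ≤ V ⊔ W))
      (inf_le_inf_right U (le_sup_right : W ≤ V ⊔ W)) (inf_sup_right _ _ _).le a
    rw [map_add, M.cor_cor, M.cor_cor]
    exact add_mem (hV b) (hW c)
  · intro x hx
    by_contra hcon
    push Not at hcon
    -- If every neighbourhood contributes an element outside `K`, these assemble to a stalk element
    -- `t` with component at `U` outside `K`. Quantifying over `V ≤ U` defines the sets for every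
    -- clopen `V`.
    obtain ⟨t, ht⟩ := M.exists_stalk_mem hx (fun V => {a | ∀ h : V ≤ U, M.cor h a ∉ K})
      (fun V => by
        rw [Set.ofPred_forall]
        exact isClosed_iInter fun h => hK.isClosed_compl.preimage (M.cor h).continuous)
      (fun V W h hWU a ha k => by
        rw [M.cor_cor]
        exact ha _)
      (fun V hxV hVU => by
        obtain ⟨b, hb⟩ := hcon V hxV
        refine ⟨M.cor inf_le_left b, fun h => ?_⟩
        rwa [M.cor_cor])
    refine ht U hx le_rfl le_rfl ?_
    rw [M.cor_self]
    refine hBK ⟨(M.toPShf.omega U).toMap ⟨⟨x, t⟩, hx⟩, ?_⟩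
    exact (M.sumEv_omega U _).trans (M.ev_of_mem (m := ⟨x, t⟩) hx)

/-- A transformation of cosheaves that is injective on stalks is injective. -/
theorem PreCoShf.injective_of_stalks [CompactSpace R] {X : Profinite.{u}}
    {F G : Clopens X ⥤ PMod R} (hF : isCosheaf R (PreCoShf.mk X F))
    (hG : isCosheaf R (PreCoShf.mk X G)) (α : ∀ U, F.obj U →L[R] G.obj U)
    (hα : ∀ U V (h : U ≤ V) (a : F.obj U),
      α V ((PreCoShf.mk X F).cor h a) = (PreCoShf.mk X G).cor h (α U a))
    (hst : ∀ (x : X) (U : Clopens X) (hx : x ∈ U) (t : (PreCoShf.mk X F).stalk x),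
      (∀ V (hV : x ∈ V), V ≤ U → α V (t.1 ⟨V, hV⟩) = 0) → t.1 ⟨U, hx⟩ = 0)
    (U : Clopens X) : Function.Injective (α U) := by
  refine (injective_iff_map_eq_zero _).mpr fun d hd => ?_
  by_contra hd0
  obtain ⟨K, hK, -, -, hdK⟩ := exists_isOpen_submodule_of_notMem (R := R)
    (P := F.obj U) (B := ⊥) (by simp) (s := d) hd0
  refine hdK ?_
  have key := clopens_induction (fun V => ∀ a : F.obj (V ⊓ U), α _ a = 0 →
    (PreCoShf.mk X F).cor inf_le_right a ∈ K) ?_ ?_ ?_ U ?_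
  · have := key ((PreCoShf.mk X F).cor (le_inf le_rfl le_rfl) d) (by rw [hα, hd, map_zero])
    rwa [PreCoShf.cor_cor, PreCoShf.cor_self] at this
  · intro a _
    rw [cor_eq_zero_of_le_bot hF _ inf_le_left]
    exact zero_mem K
  · intro V W h hW a ha
    rw [← PreCoShf.cor_cor _ (inf_le_inf_right U h) inf_le_right]
    exact hW _ (by rw [hα, ha, map_zero])
  · intro V W hVW hV hW a ha
    have h1 := inf_le_inf_right U (le_sup_left : V ≤ V ⊔ W)
    have h2 := inf_le_inf_right U (le_sup_right : W ≤ V ⊔ W)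
    obtain ⟨b, c, rfl⟩ := exists_cor_add_cor hF h1 h2 (inf_sup_right _ _ _).le a
    rw [map_add, hα, hα] at ha
    -- Disjointness enters here: over a disjoint union the target splits as a direct sum, so both
    -- parts of a kernel element are kernel elements.
    obtain ⟨hb, hc⟩ := eq_zero_of_cor_add_cor hG h1 h2 (inf_sup_right _ _ _).le
      (hVW.mono inf_le_left inf_le_left) ha
    rw [map_add, PreCoShf.cor_cor, PreCoShf.cor_cor]
    exact add_mem (hV b hb) (hW c hc)
  · intro x hx
    by_contra hcon
    push Not at hcon
    -- Local failure yields a stalk element killed by `α` whose component at `U` lies outside `K`;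
    -- by `hst` that component is zero, which is absurd.
    obtain ⟨t, ht⟩ := (PreCoShf.mk X F).exists_stalk_mem hx
      (fun V => {a | α V a = 0} ∩ {a | ∀ h : V ≤ U, (PreCoShf.mk X F).cor h a ∉ K})
      (fun V => by
        refine (isClosed_eq (α V).continuous continuous_const).inter ?_
        rw [Set.ofPred_forall]
        exact isClosed_iInter fun h =>
          hK.isClosed_compl.preimage ((PreCoShf.mk X F).cor h).continuous)
      (fun V W h hWU a ha => ⟨(hα V W h a).trans ((congrArg _ ha.1).trans (map_zero _)),
        fun k => by rw [PreCoShf.cor_cor]; exact ha.2 _⟩)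
      (fun V hxV hVU => by
        obtain ⟨b, hb, hb'⟩ := hcon V hxV
        refine ⟨(PreCoShf.mk X F).cor inf_le_left b, ?_, fun h => ?_⟩
        · exact (hα _ _ _ b).trans ((congrArg _ hb).trans (map_zero _))
        · rwa [PreCoShf.cor_cor])
    refine (ht U hx le_rfl).2 le_rfl ?_
    rw [PreCoShf.cor_self, hst x U hx t fun V hV hVU => (ht V hV hVU).1]
    exact zero_mem K

/-- Every element of the stalk at `x` of `V ↦ ⊞_{v ∈ V} M_v` comes from some `m` in the fibre `M_x`.
There evaluation returns the components of `m`, and these determine `m`. -/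
theorem PreCoShf.sumEv_injective [CompactSpace R] {M : PreCoShf R} (hM : isCosheaf R M)
    (U : Clopens M.X) : Function.Injective (M.sumEv U) := by
  refine PreCoShf.injective_of_stalks (X := M.X) (F := M.toPShf.toPreCoShf.F) (G := M.F)
    M.toPShf.isCosheaf_toPreCoShf hM M.sumEv (fun V W h a => M.sumEv_cor h a) ?_ U
  intro x U hx t ht
  obtain ⟨m, hm⟩ := M.toPShf.exists_fibreOmega_eq t
  have hm0 : m = (0 : Fibre (PreCoShf.Total.pt (M := M)) x) := M.eq_zero_of_ev hx fun V hxV hVU =>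
    (M.sumEv_omega V _).symm.trans ((congrArg (M.sumEv V) (hm V hxV)).trans (ht V hxV hVU))
  exact (hm U hx).symm.trans ((congrArg (M.toPShf.fibreOmega hx) hm0).trans
    (M.toPShf.fibreOmega_zero hx))

/-- The maps `⊞_{u ∈ U} M_u → M(U)` are compatible with morphisms of precosheaves. -/
theorem PreCoShf.Hom.app_sumEv {N M : PreCoShf R} (Φ : PreCoShf.Hom N M) {U : Clopens M.X}
    {W : Clopens N.X} (hW : W ≤ preim Φ.base U ⊓ ⊤) (a : N.toPShf.directSum W) :
    Φ.app U ⊤ (N.cor hW (N.sumEv W a)) =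
      M.sumEv U (PShf.sumHom Φ.toPShf (V := W) (U := U) (hW.trans inf_le_left) a) := by
  have : (Φ.app U ⊤).comp ((N.cor hW).comp (N.sumEv W)) =
      (M.sumEv U).comp (PShf.sumHom Φ.toPShf (V := W) (U := U) (hW.trans inf_le_left)) := by
    refine N.toPShf.directSum_ext fun m => ?_
    refine (congrArg (fun b => Φ.app U ⊤ (N.cor hW b)) (N.sumEv_omega W m)).trans ?_
    refine (congrArg (Φ.app U ⊤) (N.cor_ev hW m.2)).trans ?_
    refine Eq.trans ?_ (congrArg (M.sumEv U)
      (PShf.sumHom_omega Φ.toPShf (V := W) (U := U) (hW.trans inf_le_left) m)).symm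
    refine Eq.trans ?_ (M.sumEv_omega U _).symm
    have h1 : PreCoShf.Total.pt (M := N) m.1 ∈ preim Φ.base U ⊓ ⊤ := hW m.2
    rw [N.ev_of_mem h1]
    exact (M.ev_of_mem (m := Φ.totalMap m.1) h1.1).symm
  exact congrArg (fun φ => φ a) this

/-- The isomorphism from the cosheaf of the stalks of `M` to `M`. -/
noncomputable def PreCoShf.sumEvIso [CompactSpace R] {M : PreCoShf R} (hM : isCosheaf R M) :
    M.toPShf.toPreCoShf ≅ M :=
  PreCoShf.isoOfNatIso (X := M.X) (F := M.toPShf.toPreCoShf.F) (G := M.F) <|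
    NatIso.ofComponents (fun U => @asIso (PMod R) _ (M.toPShf.directSum U) (M.F.obj U) (M.sumEv U)
      (PMod.isIso_of_bijective _ ⟨M.sumEv_injective hM U, M.sumEv_surjective hM U⟩))
      fun h => ContinuousLinearMap.ext fun a => M.sumEv_cor h.le a

variable (R) in
/-- `CoShf` after `CoÉtale` is the identity. -/
noncomputable def coShfIso [CompactSpace R] : coEtale R ⋙ toCoShf R ≅ 𝟭 (CoShf R) :=
  NatIso.ofComponents (fun M => (isCosheaf R).isoMk (PreCoShf.sumEvIso M.property)) (by
    intro N M Ψ
    refine ObjectProperty.hom_ext _ ?_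
    let Φ : PreCoShf.Hom N.obj M.obj := Ψ.hom
    refine PreCoShf.Hom.ext' rfl fun U V hle a => ?_
    let L : PShf R := N.obj.toPShf
    have hW : preim Φ.base U ⊓ V ≤ preim Φ.base U ⊓ ⊤ := inf_le_inf_left _ le_top
    have hV : preim Φ.base U ⊓ V ≤ preim Φ.base U := inf_le_left
    let a' : L.directSum (preim Φ.base U ⊓ V) := a
    -- This is the whole content of naturality; what remains is to collapse the corestrictions that
    -- composition of precosheaf morphisms inserts.
    have h1 := Φ.app_sumEv hW a'
    have h2 : N.obj.cor (le_inf le_rfl le_top) (N.obj.sumEv (preim Φ.base U) (L.cor hV a')) =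
        N.obj.cor hW (N.obj.sumEv _ a') :=
      (congrArg _ (N.obj.sumEv_cor hV a')).trans (N.obj.cor_cor _ _ _)
    have h3 : L.cor (le_refl (preim Φ.base U ⊓ V)) a' = a' := L.cor_self le_rfl a'
    refine Eq.trans (congrArg (Φ.app U ⊤) (Eq.trans ?_ h2)) (h1.trans ?_)
    · refine congrArg (fun b => N.obj.cor _ (N.obj.sumEv (preim Φ.base U) b)) ?_
      exact (congrArg (L.toPreCoShf.cor _) (L.toPreCoShf.cor_cor _ _ _)).trans
        (L.toPreCoShf.cor_cor _ _ _)
    · let K : PShf R := M.obj.toPShf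
      refine congrArg (M.obj.sumEv U) ?_
      refine Eq.trans ?_ (K.toPreCoShf.cor_cor _ _ _).symm
      refine Eq.trans ?_ (K.cor_self le_rfl _).symm
      exact congrArg (PShf.sumHom Φ.toPShf (V := preim Φ.base U ⊓ V) (U := U) inf_le_left)
        h3.symm)

end ProfSheaf

/-- `coShf` takes values in precosheaves, so its comparison with the inverse goes through the
inclusion of cosheaves; the second equation thus includes that its values are cosheaves. -/
theorem mainTheorem5 (R : Type u) [Ring R] [TopologicalSpace R] [IsTopologicalRing R]
    [CompactSpace R] [T2Space R] [TotallyDisconnectedSpace R] :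
    ∃ e : ProfSheaf.CoShf R ≌ ProfSheaf.PShf R,
      e.functor = ProfSheaf.coEtale R ∧
      e.inverse ⋙ (ProfSheaf.isCosheaf R).ι = ProfSheaf.coShf R :=
  ⟨CategoryTheory.Equivalence.mk (ProfSheaf.coEtale R) (ProfSheaf.toCoShf R)
    (ProfSheaf.coShfIso R).symm (ProfSheaf.stalksIso R).symm, rfl, rfl⟩
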